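/- All algebras are unital and over $\mathbb{C}$. Let $A$ be a Hopf $*$-algebra, let $H$ be a compact quantum group algebra (a Hopf $*$-algebra spanned by the matrix coefficients of its finite-dimensional unitary corepresentations), and let $\pi\colon A\to H$ be a surjective homomorphism of Hopf $*$-algebras. Let $B=A^{\mathrm{co}(H)}=\{a\in A : (\mathrm{id}\otimes\pi)\Delta(a)=a\otimes 1\}$, with the left $A$-coaction given by $\Delta$, and suppose that $A$ is faithfully flat as a right $B$-module (so $B$ is a quantum homogeneous space). Let ${}^A_B\mathrm{Mod}_B$ be the category of relative Hopf modules, that is, $B$-bimodules $M$ with a left $A$-coaction $m\mapsto m_{(-1)}\otimes m_{(0)}$ satisfying $bmc\mapsto b_{(1)}m_{(-1)}c_{(1)}\otimes b_{(2)}m_{(0)}c_{(2)}$, with the $B$-bilinear $A$-colinear maps as morphisms. Let ${}^A_B\mathrm{mod}_0$ be its full subcategory of objects $M$ that are finitely generated as left $B$-modules and satisfy $MB^+=B^+M$, where $B^+=B\cap\ker\varepsilon$. Let $\Omega^{\bullet}$ be a left $A$-covariant differential $*$-calculus over $B$ with a left $A$-covariant complex structure, i.e. an $\mathbb{N}_0^2$-algebra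 grading $\Omega^\bullet=\bigoplus_{p,q}\Omega^{(p,q)}$ by left $A$-subcomodules with $\Omega^k=\bigoplus_{p+q=k}\Omega^{(p,q)}$, $(\Omega^{(p,q)})^*=\Omega^{(q,p)}$ and $d\,\Omega^{(p,q)}\subseteq\Omega^{(p+1,q)}\oplus\Omega^{(p,q+1)}$. Suppose that $\Omega^1$ is an object of ${}^A_B\mathrm{mod}_0$ and that $\Omega^{(1,0)}$ and $\Omega^{(0,1)}$ are non-isomorphic simple objects of ${}^A_B\mathrm{mod}_0$. Let $(g,(\,,\,))$ be any left $A$-covariant metric on $\Omega^1$: an element $g\in\Omega^1\otimes_B\Omega^1$ and a $B$-bilinear map $(\,,\,)\colon\Omega^1\otimes_B\Omega^1\to B$ such that $((\omega,\,\cdot\,)\otimes_B\mathrm{id})g=\omega=(\mathrm{id}\otimes_B(\,\cdot\,,\omega))g$ for all $\omega\in\Omega^1$, and such that $(\,,\,)$ and the map $B\to\Omega^1\otimes_B\Omega^1$, $b\mapsto bg$, are left $A$-colinear. Then $$(\omega,\eta)=0\quad\text{whenever }\omega,\eta\in\Omega^{(1,0)}\text{ or }\omega,\eta\in\Omega^{(0,1)},$$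 and $$g\in\big(\Omega^{(1,0)}\otimes_B\Omega^{(0,1)}\big)\oplus\big(\Omega^{(0,1)}\otimes_B\Omega^{(1,0)}\big).$$ -/

import Mathlib

open scoped TensorProduct

universe u v

noncomputable section

/-! ### Balanced tensor products over a noncommutative `ℂ`-algebra, faithful flatness -/

section Balanced

/-- The relations `m b ⊗ n = m ⊗ b n` in `M ⊗ N`, for a right `B`-module `M` and a left `B`-module
`N`. -/
def balancedRel (B : Type*) [Ring B] (M N : Type*)
    [AddCommGroup M] [Module ℂ M] [Module Bᵐᵒᵖ M] [AddCommGroup N] [Module ℂ N] [Module B N] :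
    Submodule ℂ (M ⊗[ℂ] N) :=
  Submodule.span ℂ {x | ∃ (m : M) (b : B) (n : N),
    x = (MulOpposite.op b • m) ⊗ₜ[ℂ] n - m ⊗ₜ[ℂ] (b • n)}

/-- The tensor product `M ⊗_B N` of a right and a left module over a noncommutative algebra. -/
abbrev BalTensor (B : Type*) [Ring B] (M N : Type*)
    [AddCommGroup M] [Module ℂ M] [Module Bᵐᵒᵖ M] [AddCommGroup N] [Module ℂ N] [Module B N] :
    Type _ :=
  (M ⊗[ℂ] N) ⧸ balancedRel B M N

variable (B : Type*) [Ring B]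
variable {M N : Type*} [AddCommGroup M] [Module ℂ M] [Module Bᵐᵒᵖ M]
  [AddCommGroup N] [Module ℂ N] [Module B N]

/-- The elementary tensors `m ⊗_B n`, as a bilinear map. -/
def btmul : M →ₗ[ℂ] N →ₗ[ℂ] BalTensor B M N :=
  (TensorProduct.mk ℂ M N).compr₂ (balancedRel B M N).mkQ

theorem btmul_smul (m : M) (b : B) (n : N) :
    btmul B (MulOpposite.op b • m) n = btmul B m (b • n) := by
  simp only [btmul, LinearMap.compr₂_apply, TensorProduct.mk_apply, Submodule.mkQ_apply]
  exact (Submodule.Quotient.eq _).2 (Submodule.subset_span ⟨m, b, n, rfl⟩)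

/-- A balanced bilinear map factors through `M ⊗_B N`. -/
def BalTensor.lift {P : Type*} [AddCommGroup P] [Module ℂ P] (f : M →ₗ[ℂ] N →ₗ[ℂ] P)
    (hf : ∀ (m : M) (b : B) (n : N), f (MulOpposite.op b • m) n = f m (b • n)) :
    BalTensor B M N →ₗ[ℂ] P :=
  (balancedRel B M N).liftQ (TensorProduct.lift f) (by
    refine Submodule.span_le.2 ?_
    rintro _ ⟨m, b, n, rfl⟩
    simp [hf])

@[simp]
theorem BalTensor.lift_btmul {P : Type*} [AddCommGroup P] [Module ℂ P] (f : M →ₗ[ℂ] N →ₗ[ℂ] P)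
    (hf : ∀ (m : M) (b : B) (n : N), f (MulOpposite.op b • m) n = f m (b • n)) (m : M) (n : N) :
    BalTensor.lift B f hf (btmul B m n) = f m n := by
  exact TensorProduct.lift.tmul m n

/-- `id ⊗_B f` for a left `B`-linear map `f`. -/
def BalTensor.map [Algebra ℂ B] (M : Type*) [AddCommGroup M] [Module ℂ M] [Module Bᵐᵒᵖ M]
    {N N' : Type*} [AddCommGroup N] [Module ℂ N] [Module B N] [IsScalarTower ℂ B N]
    [AddCommGroup N'] [Module ℂ N'] [Module B N'] [IsScalarTower ℂ B N'] (f : N →ₗ[B] N') :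
    BalTensor B M N →ₗ[ℂ] BalTensor B M N' :=
  BalTensor.lift B ((btmul B : M →ₗ[ℂ] N' →ₗ[ℂ] _).compl₂ (f.restrictScalars ℂ)) (by
    intro m b n
    simp [btmul_smul])

/-- A right `B`-module `M` is faithfully flat if a sequence of left `B`-modules is exact if and only
if it is exact after applying `M ⊗_B -`. -/
def IsFaithfullyFlatRight (B : Type u) [Ring B] [Algebra ℂ B] (M : Type*) [AddCommGroup M]
    [Module ℂ M] [Module Bᵐᵒᵖ M] : Prop :=
  ∀ (N₁ N₂ N₃ : Type u)
    [AddCommGroup N₁] [Module ℂ N₁] [Module B N₁] [IsScalarTower ℂ B N₁]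
    [AddCommGroup N₂] [Module ℂ N₂] [Module B N₂] [IsScalarTower ℂ B N₂]
    [AddCommGroup N₃] [Module ℂ N₃] [Module B N₃] [IsScalarTower ℂ B N₃]
    (f : N₁ →ₗ[B] N₂) (g : N₂ →ₗ[B] N₃),
    Function.Exact f g ↔ Function.Exact (BalTensor.map B M f) (BalTensor.map B M g)

/-- The right module structure of an algebra over a subalgebra, given by multiplication. -/
instance subalgebraRightModule {A : Type*} [Ring A] [Algebra ℂ A] (B : Subalgebra ℂ A) :
    Module (↥B)ᵐᵒᵖ A :=
  Module.compHom A (RingHom.op B.val.toRingHom)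

end Balanced

/-! ### Hopf `*`-algebras and compact quantum group algebras -/

/-- A Hopf `*`-algebra: a complex Hopf algebra and `*`-algebra whose coproduct is a
`*`-homomorphism. -/
class HopfStarAlgebra (A : Type*) [Ring A] [HopfAlgebra ℂ A] [StarRing A] [StarModule ℂ A] :
    Prop where
  comul_star : ∀ a : A,
    Coalgebra.comul (R := ℂ) (star a) = star (Coalgebra.comul (R := ℂ) a : A ⊗[ℂ] A)

/-- A finite-dimensional unitary corepresentation, given by its matrix of coefficients. -/
structure IsUnitaryCorep {H : Type*} [Ring H] [HopfAlgebra ℂ H] [StarRing H] {n : ℕ}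
    (w : Matrix (Fin n) (Fin n) H) : Prop where
  comul_coeff : ∀ i j, Coalgebra.comul (R := ℂ) (w i j) = ∑ k, w i k ⊗ₜ[ℂ] w k j
  counit_coeff : ∀ i j, Coalgebra.counit (R := ℂ) (w i j) = if i = j then (1 : ℂ) else 0
  unitary : w ∈ unitary (Matrix (Fin n) (Fin n) H)

/-- A Hopf `*`-algebra is a compact quantum group algebra if it is spanned by the matrix
coefficients of its finite-dimensional unitary corepresentations. -/
def IsCompactQuantumGroupAlgebra (H : Type*) [Ring H] [HopfAlgebra ℂ H] [StarRing H]
    [StarModule ℂ H] : Prop :=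
  HopfStarAlgebra H ∧
  Submodule.span ℂ {x : H | ∃ (n : ℕ) (w : Matrix (Fin n) (Fin n) H),
    IsUnitaryCorep w ∧ ∃ i j, x = w i j} = ⊤

/-! ### Restriction of coactions, the coinvariant subalgebra -/

section Restrict

variable (A : Type*) [Ring A] [Algebra ℂ A]

theorem lTensor_subtype_injective {M : Type*} [AddCommGroup M] [Module ℂ M] (W : Submodule ℂ M) :
    Function.Injective (W.subtype.lTensor A) :=
  Module.Flat.lTensor_preserves_injective_linearMap _ W.injective_subtype

/-- The corestriction of `δ : M → A ⊗ M` to a subspace `W` with `δ(W) ⊆ A ⊗ W`. -/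
def restrictCoact {M : Type*} [AddCommGroup M] [Module ℂ M] (δ : M →ₗ[ℂ] A ⊗[ℂ] M)
    (W : Submodule ℂ M) (h : ∀ w ∈ W, δ w ∈ LinearMap.range (W.subtype.lTensor A)) :
    W →ₗ[ℂ] A ⊗[ℂ] W :=
  (LinearEquiv.ofInjective _ (lTensor_subtype_injective A W)).symm.toLinearMap ∘ₗ
    (δ ∘ₗ W.subtype).codRestrict _ (fun w => h w w.2)

theorem lTensor_restrictCoact {M : Type*} [AddCommGroup M] [Module ℂ M] (δ : M →ₗ[ℂ] A ⊗[ℂ] M)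
    (W : Submodule ℂ M) (h : ∀ w ∈ W, δ w ∈ LinearMap.range (W.subtype.lTensor A)) (w : W) :
    W.subtype.lTensor A (restrictCoact A δ W h w) = δ w := by
  have := LinearEquiv.apply_symm_apply (LinearEquiv.ofInjective _ (lTensor_subtype_injective A W))
    ((δ ∘ₗ W.subtype).codRestrict _ (fun w => h w w.2) w)
  exact congrArg Subtype.val this

end Restrict

section Coinvariants

variable {A : Type u} {H : Type v} [Ring A] [HopfAlgebra ℂ A] [Ring H] [HopfAlgebra ℂ H]

/-- The coinvariants `A^{co H} = {a | (id ⊗ π) Δ(a) = a ⊗ 1}`. -/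
def coinv (π : A →ₐc[ℂ] H) : Subalgebra ℂ A :=
  AlgHom.equalizer
    ((Algebra.TensorProduct.map (AlgHom.id ℂ A) (π : A →ₐ[ℂ] H)).comp (Bialgebra.comulAlgHom ℂ A))
    (Algebra.TensorProduct.includeLeft : A →ₐ[ℂ] A ⊗[ℂ] H)

theorem mem_coinv (π : A →ₐc[ℂ] H) (a : A) :
    a ∈ coinv π ↔ (π : A →ₗ[ℂ] H).lTensor A (Coalgebra.comul (R := ℂ) a) = a ⊗ₜ[ℂ] (1 : H) :=
  Iff.rfl

theorem comul_mem_of_coinv (π : A →ₐc[ℂ] H) (b : A) (hb : b ∈ Subalgebra.toSubmodule (coinv π)) :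
    Coalgebra.comul (R := ℂ) b ∈
      LinearMap.range ((Subalgebra.toSubmodule (coinv π)).subtype.lTensor A) := by
  set i₁ : A →ₗ[ℂ] A ⊗[ℂ] H := (TensorProduct.mk ℂ A H).flip 1 with hi₁
  set f : A →ₗ[ℂ] A ⊗[ℂ] H :=
    (π : A →ₗ[ℂ] H).lTensor A ∘ₗ Coalgebra.comul - i₁ with hf
  have hker : LinearMap.ker f = Subalgebra.toSubmodule (coinv π) := by
    ext a
    rw [LinearMap.mem_ker, hf, LinearMap.sub_apply, sub_eq_zero]
    exact Iff.rfl
  rw [← hker]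
  have hex := Module.Flat.lTensor_exact (R := ℂ) A (LinearMap.exact_subtype_ker_map f)
  refine (hex _).1 ?_
  have hb' : (π : A →ₗ[ℂ] H).lTensor A (Coalgebra.comul (R := ℂ) b) = b ⊗ₜ[ℂ] (1 : H) := hb
  have h1 : ∀ x : A ⊗[ℂ] A, ((π : A →ₗ[ℂ] H).lTensor A).lTensor A
      (TensorProduct.assoc ℂ A A A ((Coalgebra.comul (R := ℂ)).rTensor A x)) =
      TensorProduct.assoc ℂ A A H ((Coalgebra.comul (R := ℂ)).rTensor H
        ((π : A →ₗ[ℂ] H).lTensor A x)) := by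
    intro x
    induction x with
    | zero => simp
    | add x y hx hy => simp only [map_add, hx, hy]
    | tmul x y =>
      simp only [LinearMap.rTensor_tmul, LinearMap.lTensor_tmul]
      generalize Coalgebra.comul (R := ℂ) x = z
      induction z with
      | zero => simp
      | add x y hx hy => simp only [TensorProduct.add_tmul, map_add, hx, hy]
      | tmul p q => simp
  have h2 : ∀ x : A ⊗[ℂ] A, TensorProduct.assoc ℂ A A H (x ⊗ₜ[ℂ] (1 : H)) = i₁.lTensor A x := by
    intro x
    induction x with
    | zero => simp
    | add x y hx hy => simp only [TensorProduct.add_tmul, map_add, hx, hy]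
    | tmul p q => simp [hi₁]
  have h3 : f.lTensor A (Coalgebra.comul (R := ℂ) b) =
      ((π : A →ₗ[ℂ] H).lTensor A).lTensor A
        ((Coalgebra.comul (R := ℂ)).lTensor A (Coalgebra.comul (R := ℂ) b)) -
      i₁.lTensor A (Coalgebra.comul (R := ℂ) b) := by
    rw [hf, LinearMap.lTensor_sub, LinearMap.lTensor_comp]
    rfl
  rw [h3, ← Coalgebra.coassoc_apply, h1, hb', LinearMap.rTensor_tmul, h2, sub_self]

/-- The left `A`-coaction on `A^{co H}` given by the coproduct, which maps `A^{co H}` to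
`A ⊗ A^{co H}`. -/
def coinvCoact (π : A →ₐc[ℂ] H) : coinv π →ₗ[ℂ] A ⊗[ℂ] coinv π :=
  restrictCoact A Coalgebra.comul (Subalgebra.toSubmodule (coinv π)) (comul_mem_of_coinv π)

end Coinvariants

/-! ### Relative Hopf modules -/

section Actions

variable (B M : Type*) [Ring B] [Algebra ℂ B] [AddCommGroup M] [Module ℂ M]

/-- `b ↦ (m ↦ b m)`. -/
def lactLin [Module B M] [IsScalarTower ℂ B M] : B →ₗ[ℂ] M →ₗ[ℂ] M :=
  LinearMap.mk₂ ℂ (fun b m => b • m) (fun _ _ _ => add_smul _ _ _) (fun _ _ _ => smul_assoc _ _ _)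
    (fun _ _ _ => smul_add _ _ _) (fun _ _ _ => smul_comm _ _ _)

/-- `m ↦ (b ↦ m b)`. -/
def ractLin [Module Bᵐᵒᵖ M] [IsScalarTower ℂ Bᵐᵒᵖ M] : M →ₗ[ℂ] B →ₗ[ℂ] M :=
  LinearMap.mk₂ ℂ (fun m b => MulOpposite.op b • m) (fun _ _ _ => smul_add _ _ _)
    (fun _ _ _ => smul_comm _ _ _) (fun _ _ _ => by rw [MulOpposite.op_add, add_smul])
    (fun _ _ _ => by rw [MulOpposite.op_smul, smul_assoc])

end Actions

variable {A : Type u} {H : Type v} [Ring A] [HopfAlgebra ℂ A] [Ring H] [HopfAlgebra ℂ H]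

/-- Objects of the category of relative Hopf modules over `B = A^{co H}`: `B`-bimodules `M` with a
left `A`-coaction `δ` such that `δ(b m c) = b₍₁₎ m₍₋₁₎ c₍₁₎ ⊗ b₍₂₎ m₍₀₎ c₍₂₎`. -/
structure RelHopfModule (π : A →ₐc[ℂ] H) where
  carrier : Type u
  [addCommGroup : AddCommGroup carrier]
  [module : Module ℂ carrier]
  [leftModule : Module (coinv π) carrier]
  [rightModule : Module (coinv π)ᵐᵒᵖ carrier]
  [leftTower : IsScalarTower ℂ (coinv π) carrier]
  [rightTower : IsScalarTower ℂ (coinv π)ᵐᵒᵖ carrier]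
  [bimodule : SMulCommClass (coinv π) (coinv π)ᵐᵒᵖ carrier]
  coact : carrier →ₗ[ℂ] A ⊗[ℂ] carrier
  coassoc : ∀ m, TensorProduct.assoc ℂ A A carrier
    ((Coalgebra.comul (R := ℂ)).rTensor carrier (coact m)) = coact.lTensor A (coact m)
  counit_coact : ∀ m,
    TensorProduct.lid ℂ carrier ((Coalgebra.counit (R := ℂ)).rTensor carrier (coact m)) = m
  coact_lsmul : ∀ (b : coinv π) (m : carrier), coact (b • m) =
    TensorProduct.map₂ (LinearMap.mul ℂ A) (lactLin (coinv π) carrier) (coinvCoact π b) (coact m)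
  coact_rsmul : ∀ (m : carrier) (b : coinv π), coact (MulOpposite.op b • m) =
    TensorProduct.map₂ (LinearMap.mul ℂ A) (ractLin (coinv π) carrier) (coact m) (coinvCoact π b)

namespace RelHopfModule

variable {π : A →ₐc[ℂ] H}

instance : CoeSort (RelHopfModule π) (Type u) := ⟨RelHopfModule.carrier⟩

attribute [instance] RelHopfModule.addCommGroup RelHopfModule.module RelHopfModule.leftModule
  RelHopfModule.rightModule RelHopfModule.leftTower RelHopfModule.rightTower
  RelHopfModule.bimodule

/-- Morphisms of relative Hopf modules: `B`-bilinear and left `A`-colinear maps. -/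
structure Hom (M N : RelHopfModule π) where
  toLin : M →ₗ[ℂ] N
  map_lsmul : ∀ (b : coinv π) (m : M), toLin (b • m) = b • toLin m
  map_rsmul : ∀ (b : coinv π) (m : M),
    toLin (MulOpposite.op b • m) = MulOpposite.op b • toLin m
  colinear : ∀ m : M, N.coact (toLin m) = toLin.lTensor A (M.coact m)

/-- Isomorphism of relative Hopf modules. -/
def Isomorphic (M N : RelHopfModule π) : Prop :=
  ∃ (f : Hom M N) (g : Hom N M), (∀ m, g.toLin (f.toLin m) = m) ∧ ∀ n, f.toLin (g.toLin n) = n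

/-- The full subcategory of relative Hopf modules `M` that are finitely generated as left
`B`-modules and satisfy `M B⁺ = B⁺ M`, where `B⁺ = B ∩ ker ε`. -/
structure IsModZero (M : RelHopfModule π) : Prop where
  finite : Module.Finite (coinv π) M
  comm_aug :
    Submodule.span ℂ {x : M | ∃ (b : coinv π) (m : M),
      Coalgebra.counit (R := ℂ) (b : A) = 0 ∧ x = MulOpposite.op b • m} =
    Submodule.span ℂ {x : M | ∃ (b : coinv π) (m : M),
      Coalgebra.counit (R := ℂ) (b : A) = 0 ∧ x = b • m}

/-- Simple objects of the full subcategory `IsModZero`: nonzero objects without subobjects other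
than `0` and the whole object. -/
structure IsSimpleModZero (M : RelHopfModule π) : Prop where
  isModZero : M.IsModZero
  nontrivial : Nontrivial M
  eq_zero_or_surjective : ∀ (N : RelHopfModule π), N.IsModZero → ∀ f : Hom N M,
    Function.Injective f.toLin → (∀ n, f.toLin n = 0) ∨ Function.Surjective f.toLin

/-- The tensor product `M ⊗_B N`. -/
abbrev Tensor (M N : RelHopfModule π) : Type u := BalTensor (coinv π) M N

/-- The elementary tensor `m ⊗_B n`. -/
abbrev tmul {M N : RelHopfModule π} (m : M) (n : N) : Tensor M N := btmul (coinv π) m n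

/-- The left action `b (m ⊗_B n) = b m ⊗_B n`. -/
def tensorLAct (M N : RelHopfModule π) (b : coinv π) : Tensor M N →ₗ[ℂ] Tensor M N :=
  BalTensor.lift (coinv π) ((btmul (coinv π)).comp (lactLin (coinv π) M b)) (by
    intro m c n
    simp only [LinearMap.comp_apply, lactLin, LinearMap.mk₂_apply]
    rw [smul_comm, btmul_smul])

/-- The right action `(m ⊗_B n) b = m ⊗_B n b`. -/
def tensorRAct (M N : RelHopfModule π) (b : coinv π) : Tensor M N →ₗ[ℂ] Tensor M N :=
  BalTensor.lift (coinv π) ((btmul (coinv π)).compl₂ ((ractLin (coinv π) N).flip b)) (by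
    intro m c n
    simp only [LinearMap.compl₂_apply, LinearMap.flip_apply, ractLin, LinearMap.mk₂_apply]
    rw [btmul_smul, smul_comm])

theorem map₂_balanced (M N : RelHopfModule π) (x : A ⊗[ℂ] M) (y : A ⊗[ℂ] coinv π)
    (z : A ⊗[ℂ] N) :
    TensorProduct.map₂ (LinearMap.mul ℂ A) (btmul (coinv π))
      (TensorProduct.map₂ (LinearMap.mul ℂ A) (ractLin (coinv π) M) x y) z =
    TensorProduct.map₂ (LinearMap.mul ℂ A) (btmul (coinv π))
      x (TensorProduct.map₂ (LinearMap.mul ℂ A) (lactLin (coinv π) N) y z) := by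
  induction x with
  | zero => simp
  | add x x' hx hx' => simp only [map_add, LinearMap.add_apply, hx, hx']
  | tmul a m =>
    induction y with
    | zero => simp
    | add y y' hy hy' => simp only [map_add, LinearMap.add_apply, hy, hy']
    | tmul a' b =>
      induction z with
      | zero => simp
      | add z z' hz hz' => simp only [map_add, hz, hz']
      | tmul a'' n =>
        change (a * a' * a'') ⊗ₜ[ℂ] btmul (coinv π) (MulOpposite.op b • m) n =
          (a * (a' * a'')) ⊗ₜ[ℂ] btmul (coinv π) m (b • n)
        rw [btmul_smul, mul_assoc]

/-- The coaction `m ⊗_B n ↦ m₍₋₁₎ n₍₋₁₎ ⊗ (m₍₀₎ ⊗_B n₍₀₎)`. -/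
def tensorCoact (M N : RelHopfModule π) : Tensor M N →ₗ[ℂ] A ⊗[ℂ] Tensor M N :=
  BalTensor.lift (coinv π)
    ((TensorProduct.map₂ (LinearMap.mul ℂ A) (btmul (coinv π))).compl₁₂ M.coact N.coact) (by
    intro m b n
    simp only [LinearMap.compl₁₂_apply]
    rw [M.coact_rsmul, N.coact_lsmul, map₂_balanced])

/-! ### Metrics -/

/-- A `B`-bilinear map `( , ) : M ⊗_B M → B`. -/
structure Pairing (M : RelHopfModule π) where
  toLin : Tensor M M →ₗ[ℂ] coinv π
  map_lact : ∀ (b : coinv π) (t : Tensor M M), toLin (tensorLAct M M b t) = b * toLin t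
  map_ract : ∀ (b : coinv π) (t : Tensor M M), toLin (tensorRAct M M b t) = toLin t * b

namespace Pairing

variable {M : RelHopfModule π}

/-- `(m, n)`. -/
def val (P : Pairing M) : M →ₗ[ℂ] M →ₗ[ℂ] coinv π := (btmul (coinv π)).compr₂ P.toLin

theorem val_lsmul (P : Pairing M) (b : coinv π) (m n : M) : P.val (b • m) n = b * P.val m n := by
  have := P.map_lact b (btmul (coinv π) m n)
  simpa [tensorLAct, lactLin, val] using this

theorem val_rsmul (P : Pairing M) (b : coinv π) (m n : M) :
    P.val m (MulOpposite.op b • n) = P.val m n * b := by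
  have := P.map_ract b (btmul (coinv π) m n)
  simpa [tensorRAct, ractLin, val] using this

/-- `((ω, ·) ⊗_B id) : M ⊗_B M → B ⊗_B M = M`, that is `m ⊗_B n ↦ (ω, m) n`. -/
def contractLeft (P : Pairing M) (ω : M) : Tensor M M →ₗ[ℂ] M :=
  BalTensor.lift (coinv π) ((lactLin (coinv π) M).comp (P.val ω)) (by
    intro m b n
    simp only [LinearMap.comp_apply, lactLin, LinearMap.mk₂_apply]
    rw [val_rsmul, mul_smul])

/-- `(id ⊗_B (·, ω)) : M ⊗_B M → M ⊗_B B = M`, that is `m ⊗_B n ↦ m (n, ω)`. -/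
def contractRight (P : Pairing M) (ω : M) : Tensor M M →ₗ[ℂ] M :=
  BalTensor.lift (coinv π) ((ractLin (coinv π) M).compl₂ (P.val.flip ω)) (by
    intro m b n
    simp only [LinearMap.compl₂_apply, LinearMap.flip_apply, ractLin, LinearMap.mk₂_apply]
    rw [val_lsmul, MulOpposite.op_mul, mul_smul])

end Pairing

/-- A metric `(g, ( , ))` on `M`:
`((ω, ·) ⊗_B id) g = ω = (id ⊗_B (·, ω)) g` for all `ω`. -/
structure Metric (M : RelHopfModule π) where
  g : Tensor M M
  pairing : Pairing M
  contractLeft_g : ∀ ω : M, pairing.contractLeft ω g = ω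
  contractRight_g : ∀ ω : M, pairing.contractRight ω g = ω

/-- The map `coev_g : B → M ⊗_B M`, `b ↦ b g`. -/
def Metric.coev {M : RelHopfModule π} (G : Metric M) : coinv π →ₗ[ℂ] Tensor M M where
  toFun b := tensorLAct M M b G.g
  map_add' b c := by
    have : tensorLAct M M (b + c) = tensorLAct M M b + tensorLAct M M c := by
      refine Submodule.linearMap_qext _ (TensorProduct.ext' fun m n => ?_)
      change tensorLAct M M (b + c) (btmul (coinv π) m n) =
        tensorLAct M M b (btmul (coinv π) m n) + tensorLAct M M c (btmul (coinv π) m n)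
      simp [tensorLAct]
    simp [this]
  map_smul' r b := by
    have : tensorLAct M M (r • b) = r • tensorLAct M M b := by
      refine Submodule.linearMap_qext _ (TensorProduct.ext' fun m n => ?_)
      change tensorLAct M M (r • b) (btmul (coinv π) m n) =
        r • tensorLAct M M b (btmul (coinv π) m n)
      simp [tensorLAct]
    simp [this]

/-- A metric is covariant if `( , )` and `coev_g` are left `A`-colinear. -/
structure Metric.IsCovariant {M : RelHopfModule π} (G : Metric M) : Prop where
  pairing_colinear : ∀ t : Tensor M M,
    coinvCoact π (G.pairing.toLin t) = G.pairing.toLin.lTensor A (tensorCoact M M t)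
  coev_colinear : ∀ b : coinv π,
    tensorCoact M M (G.coev b) = G.coev.lTensor A (coinvCoact π b)

end RelHopfModule

/-! ### Covariant differential `*`-calculi and complex structures -/

/-- A differential calculus over an algebra `B`: a differential graded algebra `Ω` with `Ω⁰ = B`
(identified through `ι`) that is generated as an algebra by `B` and `dB`. -/
structure DiffCalculus (B : Type*) [Ring B] [Algebra ℂ B] (Ω : Type*) [Ring Ω] [Algebra ℂ Ω] where
  form : ℕ → Submodule ℂ Ω
  gradedMonoid : SetLike.GradedMonoid form
  isInternal : DirectSum.IsInternal form
  ι : B →ₐ[ℂ] Ω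
  ι_injective : Function.Injective ι
  range_ι : LinearMap.range ι.toLinearMap = form 0
  d : Ω →ₗ[ℂ] Ω
  d_mem : ∀ k, ∀ ω ∈ form k, d ω ∈ form (k + 1)
  d_d : ∀ ω, d (d ω) = 0
  leibniz : ∀ k, ∀ ω ∈ form k, ∀ ν, d (ω * ν) = d ω * ν + (-1) ^ k * (ω * d ν)
  generated : Algebra.adjoin ℂ (Set.range ι ∪ Set.range fun b => d (ι b)) = ⊤

/-- A left `A`-covariant differential calculus over `B = A^{co H}`: the coaction of `B` extends to
a comodule algebra structure on `Ω` that preserves degrees and for which `d` is colinear. (Each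
`Ωᵏ` is then a relative Hopf module.) -/
structure CovariantCalculus (π : A →ₐc[ℂ] H) (Ω : Type u) [Ring Ω] [Algebra ℂ Ω] extends
    DiffCalculus (coinv π) Ω where
  coact : Ω →ₐ[ℂ] A ⊗[ℂ] Ω
  coassoc : ∀ ω, TensorProduct.assoc ℂ A A Ω
    ((Coalgebra.comul (R := ℂ)).rTensor Ω (coact ω)) = coact.toLinearMap.lTensor A (coact ω)
  counit_coact : ∀ ω,
    TensorProduct.lid ℂ Ω ((Coalgebra.counit (R := ℂ)).rTensor Ω (coact ω)) = ω
  coact_ι : ∀ b : coinv π, coact (ι b) = ι.toLinearMap.lTensor A (coinvCoact π b)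
  coact_mem : ∀ k, ∀ ω ∈ form k, coact ω ∈ LinearMap.range ((form k).subtype.lTensor A)
  coact_d : ∀ ω, coact (d ω) = d.lTensor A (coact ω)

/-- A left `A`-covariant differential `*`-calculus over `B = A^{co H}`. The involution `conj`
satisfies the graded rule `(ω ∧ ν)^* = (-1)^{kl} ν^* ∧ ω^*`. -/
structure CovariantStarCalculus [StarRing A] [StarModule ℂ A] (π : A →ₐc[ℂ] H)
    (Ω : Type u) [Ring Ω] [Algebra ℂ Ω] extends CovariantCalculus π Ω where
  conj : Ω →ₛₗ[starRingEnd ℂ] Ω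
  conj_conj : ∀ ω, conj (conj ω) = ω
  conj_ι : ∀ b b' : coinv π, (b' : A) = star (b : A) → conj (ι b) = ι b'
  conj_mem : ∀ k, ∀ ω ∈ form k, conj ω ∈ form k
  conj_d : ∀ ω, conj (d ω) = d (conj ω)
  conj_mul : ∀ k l, ∀ ω ∈ form k, ∀ ν ∈ form l,
    conj (ω * ν) = (-1) ^ (k * l) * (conj ν * conj ω)
  coact_conj : ∀ ω, coact (conj ω) =
    TensorProduct.map (starLinearEquiv ℂ (A := A)).toLinearMap conj (coact ω)

/-- A left `A`-covariant complex structure on a covariant differential `*`-calculus over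
`B = A^{co H}`: an `ℕ²`-algebra grading `Ω^{(p,q)}` by subcomodules refining the grading of `Ω`,
with `(Ω^{(p,q)})^* = Ω^{(q,p)}` and `d Ω^{(p,q)} ⊆ Ω^{(p+1,q)} ⊕ Ω^{(p,q+1)}`. -/
structure CovariantComplexStructure [StarRing A] [StarModule ℂ A] (π : A →ₐc[ℂ] H)
    (Ω : Type u) [Ring Ω] [Algebra ℂ Ω] extends CovariantStarCalculus π Ω where
  biform : ℕ × ℕ → Submodule ℂ Ω
  biform_gradedMonoid : SetLike.GradedMonoid biform
  biform_isInternal : DirectSum.IsInternal biform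
  form_eq : ∀ k, form k = ⨆ pq ∈ Finset.HasAntidiagonal.antidiagonal k, biform pq
  conj_biform : ∀ p q ω, ω ∈ biform (p, q) ↔ conj ω ∈ biform (q, p)
  d_biform : ∀ p q, ∀ ω ∈ biform (p, q), d ω ∈ biform (p + 1, q) ⊔ biform (p, q + 1)
  coact_biform : ∀ pq, ∀ ω ∈ biform pq,
    coact ω ∈ LinearMap.range ((biform pq).subtype.lTensor A)

namespace CovariantCalculus

variable {π : A →ₐc[ℂ] H} {Ω : Type u} [Ring Ω] [Algebra ℂ Ω]

/-- A subspace `W` of `Ω` that is stable under multiplication by `B` on both sides and under the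
coaction, as a relative Hopf module. -/
def subObj (C : CovariantCalculus π Ω) (W : Submodule ℂ Ω)
    (hl : ∀ (b : coinv π), ∀ ω ∈ W, C.ι b * ω ∈ W)
    (hr : ∀ (b : coinv π), ∀ ω ∈ W, ω * C.ι b ∈ W)
    (hc : ∀ ω ∈ W, C.coact ω ∈ LinearMap.range (W.subtype.lTensor A)) : RelHopfModule π :=
  letI : Module (coinv π) W :=
    { smul := fun b w => ⟨C.ι b * w, hl b w w.2⟩
      one_smul := fun w => Subtype.ext (by change C.ι 1 * (w : Ω) = w; simp)
      mul_smul := fun b c w => Subtype.ext (by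
        change C.ι (b * c) * (w : Ω) = C.ι b * (C.ι c * w); simp [mul_assoc])
      smul_zero := fun b => Subtype.ext (by change C.ι b * (0 : Ω) = 0; simp)
      smul_add := fun b x y => Subtype.ext (by
        change C.ι b * ((x : Ω) + y) = C.ι b * x + C.ι b * y; simp [mul_add])
      add_smul := fun b c x => Subtype.ext (by
        change C.ι (b + c) * (x : Ω) = C.ι b * x + C.ι c * x; simp [add_mul])
      zero_smul := fun x => Subtype.ext (by change C.ι 0 * (x : Ω) = 0; simp) }
  letI : Module (coinv π)ᵐᵒᵖ W :=
    { smul := fun b w => ⟨(w : Ω) * C.ι b.unop, hr b.unop w w.2⟩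
      one_smul := fun w => Subtype.ext (by change (w : Ω) * C.ι 1 = w; simp)
      mul_smul := fun b c w => Subtype.ext (by
        change (w : Ω) * C.ι (c.unop * b.unop) = w * C.ι c.unop * C.ι b.unop; simp [mul_assoc])
      smul_zero := fun b => Subtype.ext (by change (0 : Ω) * C.ι b.unop = 0; simp)
      smul_add := fun b x y => Subtype.ext (by
        change ((x : Ω) + y) * C.ι b.unop = x * C.ι b.unop + y * C.ι b.unop; simp [add_mul])
      add_smul := fun b c x => Subtype.ext (by
        change (x : Ω) * C.ι (b.unop + c.unop) = x * C.ι b.unop + x * C.ι c.unop; simp [mul_add])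
      zero_smul := fun x => Subtype.ext (by change (x : Ω) * C.ι 0 = 0; simp) }
  haveI : IsScalarTower ℂ (coinv π) W := ⟨fun r b w => Subtype.ext (by
    change C.ι (r • b) * (w : Ω) = r • (C.ι b * w); simp)⟩
  haveI : IsScalarTower ℂ (coinv π)ᵐᵒᵖ W := ⟨fun r b w => Subtype.ext (by
    change (w : Ω) * C.ι (r • b.unop) = r • (w * C.ι b.unop); simp)⟩
  haveI : SMulCommClass (coinv π) (coinv π)ᵐᵒᵖ W := ⟨fun b c w => Subtype.ext (by
    change C.ι b * ((w : Ω) * C.ι c.unop) = C.ι b * w * C.ι c.unop; rw [mul_assoc])⟩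
  have key : ∀ w : W, W.subtype.lTensor A (restrictCoact A C.coact.toLinearMap W hc w) =
    C.coact w := lTensor_restrictCoact A C.coact.toLinearMap W hc
  { carrier := W
    coact := restrictCoact A C.coact.toLinearMap W hc
    coassoc := fun w => by
      have hinj : Function.Injective ((W.subtype.lTensor A).lTensor A) :=
        Module.Flat.lTensor_preserves_injective_linearMap _ (lTensor_subtype_injective A W)
      have h1 : ∀ x : A ⊗[ℂ] W, (W.subtype.lTensor A).lTensor A
          (TensorProduct.assoc ℂ A A W ((Coalgebra.comul (R := ℂ)).rTensor W x)) =
          TensorProduct.assoc ℂ A A Ω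
            ((Coalgebra.comul (R := ℂ)).rTensor Ω (W.subtype.lTensor A x)) := by
        intro x
        induction x with
        | zero => simp
        | add x y hx hy => simp only [map_add, hx, hy]
        | tmul x y =>
          simp only [LinearMap.rTensor_tmul, LinearMap.lTensor_tmul]
          generalize Coalgebra.comul (R := ℂ) x = z
          induction z with
          | zero => simp
          | add x y hx hy => simp only [TensorProduct.add_tmul, map_add, hx, hy]
          | tmul p q => simp
      have h2 : ∀ x : A ⊗[ℂ] W, (W.subtype.lTensor A).lTensor A
          ((restrictCoact A C.coact.toLinearMap W hc).lTensor A x) =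
          C.coact.toLinearMap.lTensor A (W.subtype.lTensor A x) := by
        intro x
        induction x with
        | zero => simp
        | add x y hx hy => simp only [map_add, hx, hy]
        | tmul x y => simp [key]
      apply hinj
      rw [h1, h2, key, C.coassoc]
    counit_coact := fun w => by
      have h1 : ∀ x : A ⊗[ℂ] W,
          ((TensorProduct.lid ℂ W ((Coalgebra.counit (R := ℂ)).rTensor W x) : W) : Ω) =
          TensorProduct.lid ℂ Ω
            ((Coalgebra.counit (R := ℂ)).rTensor Ω (W.subtype.lTensor A x)) := by
        intro x
        induction x with
        | zero => simp
        | add x y hx hy => simp only [map_add, Submodule.coe_add, hx, hy]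
        | tmul x y => simp
      apply Subtype.ext
      rw [h1, key, C.counit_coact]
    coact_lsmul := fun b w => by
      have h1 : ∀ (x : A ⊗[ℂ] coinv π) (y : A ⊗[ℂ] W), W.subtype.lTensor A
          (TensorProduct.map₂ (LinearMap.mul ℂ A) (lactLin (coinv π) W) x y) =
          C.ι.toLinearMap.lTensor A x * W.subtype.lTensor A y := by
        intro x y
        induction x with
        | zero => simp
        | add x x' hx hx' => simp only [map_add, LinearMap.add_apply, add_mul, hx, hx']
        | tmul a c =>
          induction y with
          | zero => simp
          | add y y' hy hy' => simp only [map_add, mul_add, hy, hy']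
          | tmul a' w =>
            simp only [TensorProduct.map₂_apply_tmul, LinearMap.lTensor_tmul,
              Algebra.TensorProduct.tmul_mul_tmul]
            rfl
      apply lTensor_subtype_injective A W
      rw [h1, key, key, ← C.coact_ι, ← map_mul]
      rfl
    coact_rsmul := fun w b => by
      have h1 : ∀ (x : A ⊗[ℂ] W) (y : A ⊗[ℂ] coinv π), W.subtype.lTensor A
          (TensorProduct.map₂ (LinearMap.mul ℂ A) (ractLin (coinv π) W) x y) =
          W.subtype.lTensor A x * C.ι.toLinearMap.lTensor A y := by
        intro x y
        induction x with
        | zero => simp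
        | add x x' hx hx' => simp only [map_add, LinearMap.add_apply, add_mul, hx, hx']
        | tmul a c =>
          induction y with
          | zero => simp
          | add y y' hy hy' => simp only [map_add, mul_add, hy, hy']
          | tmul a' w =>
            simp only [TensorProduct.map₂_apply_tmul, LinearMap.lTensor_tmul,
              Algebra.TensorProduct.tmul_mul_tmul]
            rfl
      apply lTensor_subtype_injective A W
      rw [h1, key, key, ← C.coact_ι, ← map_mul]
      rfl }

theorem ι_mem (C : CovariantCalculus π Ω) (b : coinv π) : C.ι b ∈ C.form 0 :=
  C.range_ι ▸ ⟨b, rfl⟩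

/-- The relative Hopf module `Ωᵏ`. -/
def formObj (C : CovariantCalculus π Ω) (k : ℕ) : RelHopfModule π :=
  C.subObj (C.form k)
    (fun b ω hω => by
      have := C.gradedMonoid
      simpa using SetLike.mul_mem_graded (C.ι_mem b) hω)
    (fun b ω hω => by
      have := C.gradedMonoid
      simpa using SetLike.mul_mem_graded hω (C.ι_mem b))
    (C.coact_mem k)

end CovariantCalculus

namespace CovariantComplexStructure

variable [StarRing A] [StarModule ℂ A] {π : A →ₐc[ℂ] H} {Ω : Type u} [Ring Ω] [Algebra ℂ Ω]

theorem ι_mem_biform (C : CovariantComplexStructure π Ω) (b : coinv π) :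
    C.ι b ∈ C.biform (0, 0) := by
  have h := C.toCovariantCalculus.ι_mem b
  rw [C.form_eq] at h
  simpa using h

/-- The relative Hopf module `Ω^{(p,q)}`. -/
def biformObj (C : CovariantComplexStructure π Ω) (p q : ℕ) : RelHopfModule π :=
  C.toCovariantCalculus.subObj (C.biform (p, q))
    (fun b ω hω => by
      have := C.biform_gradedMonoid
      simpa using SetLike.mul_mem_graded (C.ι_mem_biform b) hω)
    (fun b ω hω => by
      have := C.biform_gradedMonoid
      simpa using SetLike.mul_mem_graded hω (C.ι_mem_biform b))
    (C.coact_biform (p, q))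

/-- The relative Hopf module `Ω¹` of one-forms. -/
abbrev oneForms (C : CovariantComplexStructure π Ω) : RelHopfModule π :=
  C.toCovariantCalculus.formObj 1

/-- `Ω^{(1,0)}` as a subspace of `Ω¹`. -/
def holForms (C : CovariantComplexStructure π Ω) : Submodule ℂ C.oneForms :=
  (C.biform (1, 0)).comap (C.form 1).subtype

/-- `Ω^{(0,1)}` as a subspace of `Ω¹`. -/
def antiholForms (C : CovariantComplexStructure π Ω) : Submodule ℂ C.oneForms :=
  (C.biform (0, 1)).comap (C.form 1).subtype

end CovariantComplexStructure

/-- The subspace of `M ⊗_B N` spanned by the `m ⊗_B n` with `m ∈ U`, `n ∈ V`. -/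
def RelHopfModule.tensorSpan {π : A →ₐc[ℂ] H} {M N : RelHopfModule π} (U : Submodule ℂ M)
    (V : Submodule ℂ N) : Submodule ℂ (RelHopfModule.Tensor M N) :=
  Submodule.map₂ (btmul (coinv π)) U V

end

/-! Let V and V' be the fibres M / B⁺M of Ω^{(1,0)} and Ω^{(0,1)}, with their left H-coactions [m] ↦
π(m₍₋₁₎) ⊗ [m₍₀₎]. A bilinear colinear pairing on Ω^{(1,0)} descends, after applying ε, to an
H-invariant bilinear form β on V, and β determines it: (m, n) = m₍₋₁₎ n₍₋₁₎ β([m₍₀₎], [n₍₀₎])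
(`eq_zero_of_fibreForm_eq_zero`). The involution makes V' the conjugate of V. A nonzero invariant
form on the simple comodule V would identify V with its dual, and unitarity identifies the dual with
the conjugate, so V ≅ V' and then Ω^{(1,0)} ≅ Ω^{(0,1)}, against the hypothesis. Hence β = 0. The
isomorphism is explicit, x ↦ ∑ β(v_k, x) v_k^* (`exists_colinear_of_form`, `pairing_eq_zero`); the
case of Ω^{(0,1)} is symmetric.

This requires a passage from fibres back to relative Hopf modules, which the Haar functional h of H
provides (`exists_haar`). The expectation E(a) = a₍₁₎ h(π(a₍₂₎)) maps A to B and is right B-linear,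
and a ⊗ [m] ↦ E(a S(m₍₋₁₎)) m₍₀₎ is a left inverse of m ↦ m₍₋₁₎ ⊗ [m₍₀₎] (`counit'_unit`). Through
it, colinear maps of fibres lift functorially to morphisms (`liftHom`, `liftLin_comp`). Comodules
over H are semisimple (`isSemisimpleModule_coactOp`) and idempotents of the fibre lift, so a simple
object has a simple fibre (`isSimpleModule_fibre`) and Schur's lemma applies to V and V'.

The claim about g is then linear algebra. Write U and V for the two isotropic summands of Ω¹ and
split g into its four components. Contracting g with ω ∈ U must return ω ∈ U, so the V ⊗ V component
contributes nothing; contracting with ω ∈ V kills it by isotropy. A tensor all of whose contractions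
vanish is zero (`Metric.eq_zero_of_contract_eq_zero`), and the U ⊗ U component is handled in the
same way. -/

noncomputable section

/-! ### Vector spaces with a family of operators -/

/-- A vector space `X` with operators `ρ i`, as a module over the free algebra. -/
def OpMod {ι X : Type*} [AddCommGroup X] [Module ℂ X] (_ρ : ι → Module.End ℂ X) : Type _ := X

namespace OpMod

variable {ι X Y : Type*} [AddCommGroup X] [Module ℂ X] [AddCommGroup Y] [Module ℂ Y]
  {ρ : ι → Module.End ℂ X} {σ : ι → Module.End ℂ Y}

instance (ρ : ι → Module.End ℂ X) : AddCommGroup (OpMod ρ) := inferInstanceAs (AddCommGroup X)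

instance (ρ : ι → Module.End ℂ X) : Module ℂ (OpMod ρ) := inferInstanceAs (Module ℂ X)

instance (ρ : ι → Module.End ℂ X) : Module (FreeAlgebra ℂ ι) (OpMod ρ) :=
  Module.compHom X (FreeAlgebra.lift ℂ ρ).toRingHom

/-- The identification of `X` with `OpMod ρ`. -/
def of (ρ : ι → Module.End ℂ X) : X ≃ₗ[ℂ] OpMod ρ := LinearEquiv.refl ℂ X

theorem smul_of (r : FreeAlgebra ℂ ι) (x : X) :
    r • of ρ x = of ρ (FreeAlgebra.lift ℂ ρ r x) := rfl

theorem ι_smul_of (i : ι) (x : X) : FreeAlgebra.ι ℂ i • of ρ x = of ρ (ρ i x) := by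
  rw [smul_of, FreeAlgebra.lift_ι_apply]

instance : IsScalarTower ℂ (FreeAlgebra ℂ ι) (OpMod ρ) where
  smul_assoc c r x := by
    obtain ⟨x, rfl⟩ := (of ρ).surjective x
    rw [smul_of, smul_of, map_smul, LinearMap.smul_apply, map_smul]

/-- A linear map commuting with the operators is linear over the free algebra. -/
def homOf (f : X →ₗ[ℂ] Y) (h : ∀ i x, f (ρ i x) = σ i (f x)) :
    OpMod ρ →ₗ[FreeAlgebra ℂ ι] OpMod σ where
  toFun x := of σ (f ((of ρ).symm x))
  map_add' x y := by simp
  map_smul' r x := by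
    obtain ⟨x, rfl⟩ := (of ρ).surjective x
    simp only [RingHom.id_apply, smul_of, LinearEquiv.symm_apply_apply]
    congr 1
    induction r generalizing x with
    | grade0 c => simp
    | grade1 i => simp [h]
    | mul a b ha hb => simp [ha, hb]
    | add a b ha hb => simp [ha, hb]

@[simp]
theorem homOf_of (f : X →ₗ[ℂ] Y) (h : ∀ i x, f (ρ i x) = σ i (f x)) (x : X) :
    homOf f h (of ρ x) = of σ (f x) := rfl

/-- The underlying linear map of a map over the free algebra. -/
def toLin (f : OpMod ρ →ₗ[FreeAlgebra ℂ ι] OpMod σ) : X →ₗ[ℂ] Y :=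
  (of σ).symm.toLinearMap ∘ₗ f.restrictScalars ℂ ∘ₗ (of ρ).toLinearMap

theorem of_toLin (f : OpMod ρ →ₗ[FreeAlgebra ℂ ι] OpMod σ) (x : X) :
    of σ (toLin f x) = f (of ρ x) := rfl

theorem toLin_comm (f : OpMod ρ →ₗ[FreeAlgebra ℂ ι] OpMod σ) (i : ι) (x : X) :
    toLin f (ρ i x) = σ i (toLin f x) := by
  apply (of σ).injective
  rw [of_toLin, ← ι_smul_of, f.map_smul, ← of_toLin, ι_smul_of]

/-- A subspace stable under the operators is a submodule over the free algebra. -/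
def sub (W : Submodule ℂ X) (h : ∀ i, ∀ x ∈ W, ρ i x ∈ W) :
    Submodule (FreeAlgebra ℂ ι) (OpMod ρ) where
  carrier := of ρ '' W
  add_mem' := by
    rintro _ _ ⟨x, hx, rfl⟩ ⟨y, hy, rfl⟩
    exact ⟨x + y, W.add_mem hx hy, map_add _ _ _⟩
  zero_mem' := ⟨0, W.zero_mem, map_zero _⟩
  smul_mem' r x hx := by
    obtain ⟨x, hx, rfl⟩ := hx
    refine ⟨_, ?_, (smul_of r x).symm⟩
    change _ ∈ W
    change x ∈ W at hx
    induction r generalizing x with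
    | grade0 c => simpa using W.smul_mem c hx
    | grade1 i => simpa using h i x hx
    | mul a b ha hb => simpa using ha _ (hb x hx)
    | add a b ha hb => simpa using W.add_mem (ha x hx) (hb x hx)

theorem of_mem_sub {W : Submodule ℂ X} {h : ∀ i, ∀ x ∈ W, ρ i x ∈ W} {x : X} :
    of ρ x ∈ sub W h ↔ x ∈ W :=
  ⟨fun ⟨_, hy, e⟩ => (of ρ).injective e ▸ hy, fun hx => ⟨x, hx, rfl⟩⟩

/-- The subspace underlying a submodule over the free algebra. -/
def subC (W : Submodule (FreeAlgebra ℂ ι) (OpMod ρ)) : Submodule ℂ X :=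
  (W.restrictScalars ℂ).comap (of ρ).toLinearMap

theorem mem_subC {W : Submodule (FreeAlgebra ℂ ι) (OpMod ρ)} {x : X} :
    x ∈ subC W ↔ of ρ x ∈ W := Iff.rfl

theorem subC_stable (W : Submodule (FreeAlgebra ℂ ι) (OpMod ρ)) (i : ι) (x : X) (hx : x ∈ subC W) :
    ρ i x ∈ subC W := by
  rw [mem_subC, ← ι_smul_of]
  exact W.smul_mem _ hx

/-- A family of operators closed under adjoints is semisimple. -/
theorem isSemisimpleModule_of_adjoint {X : Type*} [NormedAddCommGroup X] [InnerProductSpace ℂ X]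
    [FiniteDimensional ℂ X] {ρ : ι → Module.End ℂ X}
    (h : ∀ i, ∃ j, ρ j = LinearMap.adjoint (ρ i)) :
    IsSemisimpleModule (FreeAlgebra ℂ ι) (OpMod ρ) where
  exists_isCompl W := by
    -- The orthogonal complement is the invariant complement: moving ρ i to the other side of the
    -- inner product gives some ρ j, which preserves W.
    have hs : ∀ i, ∀ x ∈ (subC W)ᗮ, ρ i x ∈ (subC W)ᗮ := by
      intro i x hx
      obtain ⟨j, hj⟩ := h i
      refine (Submodule.mem_orthogonal _ _).2 fun u hu => ?_
      rw [← LinearMap.adjoint_inner_left, ← hj]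
      exact (Submodule.mem_orthogonal _ _).1 hx _ (subC_stable W j u hu)
    have hc := Submodule.isCompl_orthogonal (K := subC W)
    refine ⟨sub (subC W)ᗮ hs, ?_, ?_⟩
    · rw [Submodule.disjoint_def]
      intro x hx hx'
      obtain ⟨x, rfl⟩ := (of ρ).surjective x
      rw [Submodule.disjoint_def.1 hc.disjoint x hx (of_mem_sub.1 hx'), map_zero]
    · rw [codisjoint_iff, eq_top_iff]
      intro x _
      obtain ⟨x, rfl⟩ := (of ρ).surjective x
      obtain ⟨y, hy, z, hz, rfl⟩ := Submodule.mem_sup.1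
        (hc.sup_eq_top.symm ▸ Submodule.mem_top : x ∈ subC W ⊔ (subC W)ᗮ)
      rw [map_add]
      exact Submodule.add_mem_sup hy (of_mem_sub.2 hz)

end OpMod

/-! ### Comodules over a compact quantum group algebra are semisimple -/

section Semisimple

variable {K : Type*} [AddCommGroup K] [Module ℂ K]

/-- `k ⊗ x ↦ φ(k) x`. -/
def slice (X : Type*) [AddCommGroup X] [Module ℂ X] (φ : Module.Dual ℂ K) : K ⊗[ℂ] X →ₗ[ℂ] X :=
  (TensorProduct.lid ℂ X).toLinearMap ∘ₗ φ.rTensor X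

@[simp]
theorem slice_tmul {X : Type*} [AddCommGroup X] [Module ℂ X] (φ : Module.Dual ℂ K) (k : K) (x : X) :
    slice X φ (k ⊗ₜ x) = φ k • x := by
  simp [slice]

theorem slice_lTensor {X Y : Type*} [AddCommGroup X] [Module ℂ X] [AddCommGroup Y] [Module ℂ Y]
    (f : X →ₗ[ℂ] Y) (φ : Module.Dual ℂ K) (t : K ⊗[ℂ] X) :
    slice Y φ (f.lTensor K t) = f (slice X φ t) := by
  induction t with
  | zero => simp
  | add s t hs ht => simp only [map_add, hs, ht]
  | tmul k x => simp

/-- The functionals on the first factor separate the points of a tensor product. -/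
theorem eq_of_slice_eq {X : Type*} [AddCommGroup X] [Module ℂ X] {s t : K ⊗[ℂ] X}
    (h : ∀ φ : Module.Dual ℂ K, slice X φ s = slice X φ t) : s = t := by
  classical
  let b := Module.Basis.ofVectorSpace ℂ K
  apply (TensorProduct.equivFinsuppOfBasisLeft b).injective
  ext i
  have key : ∀ t : K ⊗[ℂ] X,
      TensorProduct.equivFinsuppOfBasisLeft b t i = slice X (b.coord i) t := by
    intro t
    induction t with
    | zero => simp
    | add s t hs ht => simp only [map_add, Finsupp.add_apply, hs, ht]
    | tmul k x => simp
  rw [key, key, h]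

/-- The operators on `X` given by a map `δ : X → K ⊗ X` and the functionals on `K`. -/
def coactOp {X : Type*} [AddCommGroup X] [Module ℂ X] (δ : X →ₗ[ℂ] K ⊗[ℂ] X)
    (φ : Module.Dual ℂ K) : Module.End ℂ X :=
  slice X φ ∘ₗ δ

theorem coactOp_apply {X : Type*} [AddCommGroup X] [Module ℂ X] (δ : X →ₗ[ℂ] K ⊗[ℂ] X)
    (φ : Module.Dual ℂ K) (x : X) : coactOp δ φ x = slice X φ (δ x) := rfl

variable {X Y : Type*} [AddCommGroup X] [Module ℂ X] [AddCommGroup Y] [Module ℂ Y]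
  {δ : X →ₗ[ℂ] K ⊗[ℂ] X} {δ' : Y →ₗ[ℂ] K ⊗[ℂ] Y}

/-- Functionals on K separate the points of K ⊗ Y. Colinear maps are therefore exactly the maps
linear over the free algebra on the dual of K, so module theory (semisimplicity, Schur) applies to
comodules. -/
theorem coactOp_comm_iff (f : X →ₗ[ℂ] Y) :
    (∀ φ x, f (coactOp δ φ x) = coactOp δ' φ (f x)) ↔ ∀ x, δ' (f x) = f.lTensor K (δ x) := by
  simp only [coactOp_apply, ← slice_lTensor]
  exact ⟨fun h x => eq_of_slice_eq fun φ => (h φ x).symm, fun h φ x => by rw [h]⟩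

end Semisimple

/-! ### Unitary corepresentations, complete reducibility and the Haar functional. -/

section Haar

variable {H : Type v} [Ring H] [HopfAlgebra ℂ H]

/-- The antipode axiom makes S(w) a left inverse of w, unitarity makes w^* a right inverse, so they
coincide. -/
theorem IsUnitaryCorep.antipode_coeff [StarRing H] {n : ℕ} {w : Matrix (Fin n) (Fin n) H}
    (hw : IsUnitaryCorep w) (i j : Fin n) :
    HopfAlgebra.antipode ℂ (w i j) = star (w j i) := by
  have h1 : w.map (HopfAlgebra.antipode ℂ) * w = 1 := by
    ext i j
    have := HopfAlgebra.mul_antipode_rTensor_comul_apply (R := ℂ) (w i j)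
    rw [hw.comul_coeff, hw.counit_coeff] at this
    simpa [Matrix.mul_apply, Matrix.one_apply, apply_ite] using this
  have h2 : w.map (HopfAlgebra.antipode ℂ) = star w :=
    left_inv_eq_right_inv h1 (Unitary.mul_star_self_of_mem hw.unitary)
  exact congrFun (congrFun h2 i) j

/-- The operators on `ℂⁿ` given by a matrix of coefficients. -/
def corepOp {n : ℕ} (w : Matrix (Fin n) (Fin n) H) (φ : Module.Dual ℂ H) :
    Module.End ℂ (EuclideanSpace ℂ (Fin n)) :=
  -- The transpose appears because the left coaction is e_i ↦ ∑ w_ik ⊗ e_k.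
  Matrix.toEuclideanLin (Matrix.of fun k i => φ (w i k))

/-- The operators are closed under adjoints: the adjoint of the one for φ belongs to x ↦ conj
φ(S(x)^*), because S(w_ik)^* = w_ki. -/
theorem IsUnitaryCorep.isSemisimpleModule [StarRing H] [StarModule ℂ H] {n : ℕ} {w : Matrix (Fin n) (Fin n) H}
    (hw : IsUnitaryCorep w) :
    IsSemisimpleModule (FreeAlgebra ℂ (Module.Dual ℂ H)) (OpMod (corepOp w)) := by
  refine OpMod.isSemisimpleModule_of_adjoint fun φ => ?_
  let ψ : Module.Dual ℂ H :=
    { toFun := fun x => star (φ (star (HopfAlgebra.antipode ℂ x)))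
      map_add' := fun x y => by simp
      map_smul' := fun c x => by simp }
  refine ⟨ψ, ?_⟩
  rw [corepOp, corepOp, ← Matrix.toEuclideanLin_conjTranspose_eq_adjoint]
  congr 1
  ext k i
  change star (φ (star (HopfAlgebra.antipode ℂ (w i k)))) = star (φ (w k i))
  rw [hw.antipode_coeff, star_star]

/-- The map `ℂⁿ → H`, `e_i ↦ w_ij`. -/
def corepCol {n : ℕ} (w : Matrix (Fin n) (Fin n) H) (j : Fin n) :
    EuclideanSpace ℂ (Fin n) →ₗ[ℂ] H :=
  ∑ i, (LinearMap.toSpanSingleton ℂ H (w i j)) ∘ₗ (EuclideanSpace.proj i).toLinearMap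

theorem corepCol_apply {n : ℕ} (w : Matrix (Fin n) (Fin n) H) (j : Fin n)
    (x : EuclideanSpace ℂ (Fin n)) : corepCol w j x = ∑ i, x i • w i j := by
  simp [corepCol]

theorem corepCol_single {n : ℕ} (w : Matrix (Fin n) (Fin n) H) (i j : Fin n) :
    corepCol w j (EuclideanSpace.single i 1) = w i j := by
  simp [corepCol_apply]

theorem IsUnitaryCorep.corepCol_comm [StarRing H] {n : ℕ} {w : Matrix (Fin n) (Fin n) H}
    (hw : IsUnitaryCorep w) (j : Fin n) (φ : Module.Dual ℂ H) (x : EuclideanSpace ℂ (Fin n)) :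
    corepCol w j (corepOp w φ x) = coactOp Coalgebra.comul φ (corepCol w j x) := by
  simp only [corepCol_apply, coactOp_apply, map_sum, map_smul, hw.comul_coeff, slice_tmul, corepOp,
    Matrix.toLpLin_apply, Matrix.mulVec, dotProduct, Matrix.of_apply, Finset.smul_sum,
    Finset.sum_smul]
  rw [Finset.sum_comm]
  simp only [smul_smul, mul_comm]

/-- Matrix coefficients span H, so H is the sum of the images of the colinear column maps e_i ↦
w_ij, each a quotient of a semisimple module. -/
theorem isSemisimpleModule_of_cqg [StarRing H] [StarModule ℂ H]
    (hH : IsCompactQuantumGroupAlgebra H) :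
    IsSemisimpleModule (FreeAlgebra ℂ (Module.Dual ℂ H))
      (OpMod (coactOp (Coalgebra.comul (R := ℂ) (A := H)))) := by
  let I := {p : (n : ℕ) × Matrix (Fin n) (Fin n) H × Fin n // IsUnitaryCorep p.2.1}
  let p : I → Submodule (FreeAlgebra ℂ (Module.Dual ℂ H))
      (OpMod (coactOp (Coalgebra.comul (R := ℂ) (A := H)))) := fun i =>
    LinearMap.range (OpMod.homOf (corepCol i.1.2.1 i.1.2.2) (i.2.corepCol_comm i.1.2.2))
  refine isSemisimpleModule_of_isSemisimpleModule_submodule' (p := p) (fun i => ?_) ?_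
  · have := i.2.isSemisimpleModule
    exact IsSemisimpleModule.range _
  · rw [eq_top_iff]
    intro x _
    obtain ⟨x, rfl⟩ := (OpMod.of _).surjective x
    have hx : x ∈ OpMod.subC (⨆ i, p i) := by
      have h := hH.2
      rw [eq_top_iff] at h
      refine (h.trans ?_) Submodule.mem_top
      refine Submodule.span_le.2 ?_
      rintro _ ⟨n, w, hw, i, j, rfl⟩
      refine (le_iSup p ⟨⟨n, w, j⟩, hw⟩) ⟨OpMod.of _ (EuclideanSpace.single i 1), ?_⟩
      exact congrArg (OpMod.of (coactOp (Coalgebra.comul (R := ℂ) (A := H)))) (corepCol_single w i j)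
    exact hx

/-- A comodule over a compact quantum group algebra is semisimple. -/
theorem isSemisimpleModule_coactOp [StarRing H] [StarModule ℂ H]
    (hH : IsCompactQuantumGroupAlgebra H) {X : Type*}
    [AddCommGroup X] [Module ℂ X] (δ : X →ₗ[ℂ] H ⊗[ℂ] X)
    (coassoc : ∀ x, TensorProduct.assoc ℂ H H X
      ((Coalgebra.comul (R := ℂ)).rTensor X (δ x)) = δ.lTensor H (δ x))
    (counit : ∀ x, slice X Coalgebra.counit (δ x) = x) :
    IsSemisimpleModule (FreeAlgebra ℂ (Module.Dual ℂ H)) (OpMod (coactOp δ)) := by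
  have := isSemisimpleModule_of_cqg hH
  -- The cofree comodule H ⊗ X, coacted on through its first leg, is a sum of images of H.
  -- Coassociativity makes δ a colinear map into it and the counit makes δ injective, so X inherits
  -- semisimplicity.
  let τ : H ⊗[ℂ] X →ₗ[ℂ] H ⊗[ℂ] (H ⊗[ℂ] X) :=
    (TensorProduct.assoc ℂ H H X).toLinearMap ∘ₗ (Coalgebra.comul (R := ℂ)).rTensor X
  have hτ : ∀ (x : X) (φ : Module.Dual ℂ H) (h : H), (TensorProduct.mk ℂ H X).flip x
      (coactOp Coalgebra.comul φ h) = coactOp τ φ ((TensorProduct.mk ℂ H X).flip x h) := by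
    intro x φ h
    simp only [coactOp_apply, LinearMap.flip_apply, TensorProduct.mk_apply, τ,
      LinearMap.comp_apply, LinearMap.rTensor_tmul, LinearEquiv.coe_coe]
    generalize Coalgebra.comul (R := ℂ) h = z
    induction z with
    | zero => simp
    | add s t hs ht => simp only [map_add, TensorProduct.add_tmul, hs, ht]
    | tmul a b => simp [TensorProduct.smul_tmul']
  have hss : IsSemisimpleModule (FreeAlgebra ℂ (Module.Dual ℂ H)) (OpMod (coactOp τ)) := by
    let p : X → Submodule (FreeAlgebra ℂ (Module.Dual ℂ H)) (OpMod (coactOp τ)) := fun x =>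
      LinearMap.range (OpMod.homOf ((TensorProduct.mk ℂ H X).flip x) (hτ x))
    refine isSemisimpleModule_of_isSemisimpleModule_submodule' (p := p)
      (fun x => IsSemisimpleModule.range _) ?_
    rw [eq_top_iff]
    intro t _
    obtain ⟨t, rfl⟩ := (OpMod.of _).surjective t
    induction t with
    | zero => simp
    | add s t hs ht => rw [map_add]; exact Submodule.add_mem _ (hs trivial) (ht trivial)
    | tmul h x => exact (le_iSup p x) ⟨OpMod.of _ h, rfl⟩
  refine IsSemisimpleModule.of_injective (OpMod.homOf (σ := coactOp τ) δ
    ((coactOp_comm_iff δ).2 coassoc)) fun x y h => ?_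
  obtain ⟨x, rfl⟩ := (OpMod.of _).surjective x
  obtain ⟨y, rfl⟩ := (OpMod.of _).surjective y
  rw [OpMod.homOf_of, OpMod.homOf_of] at h
  rw [← counit x, ← counit y, (OpMod.of _).injective h]

/-- The Haar functional of a compact quantum group algebra. -/
theorem exists_haar [StarRing H] [StarModule ℂ H]
    (hH : IsCompactQuantumGroupAlgebra H) :
    ∃ h : Module.Dual ℂ H, h 1 = 1 ∧ ∀ x : H,
      TensorProduct.rid ℂ H (h.lTensor H (Coalgebra.comul (R := ℂ) x)) = h x • (1 : H) := by
  have := isSemisimpleModule_of_cqg hH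
  rcases subsingleton_or_nontrivial H with hs | hn
  · have := congrArg (Coalgebra.counit (R := ℂ)) (Subsingleton.elim (1 : H) 0)
    simp at this
  -- The functional is a colinear retraction of the unit map from the trivial comodule ℂ into H:
  -- retraction gives h(1) = 1, colinearity gives invariance.
  let δ₁ : ℂ →ₗ[ℂ] H ⊗[ℂ] ℂ := (TensorProduct.mk ℂ H ℂ) 1
  let u : OpMod (coactOp δ₁) →ₗ[FreeAlgebra ℂ (Module.Dual ℂ H)]
      OpMod (coactOp (Coalgebra.comul (R := ℂ) (A := H))) :=
    OpMod.homOf (Algebra.linearMap ℂ H) (by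
      refine (coactOp_comm_iff _).2 fun x => ?_
      simp [δ₁, Algebra.algebraMap_eq_smul_one, TensorProduct.tmul_smul,
        Algebra.TensorProduct.one_def])
  have hu : Function.Injective u := by
    intro x y h
    obtain ⟨x, rfl⟩ := (OpMod.of _).surjective x
    obtain ⟨y, rfl⟩ := (OpMod.of _).surjective y
    exact congrArg (OpMod.of _) ((algebraMap ℂ H).injective ((OpMod.of _).injective h))
  obtain ⟨r, hr⟩ := IsSemisimpleModule.extension_property u hu LinearMap.id
  refine ⟨OpMod.toLin r, ?_, fun x => ?_⟩
  · have := congrArg (fun f => (OpMod.of _).symm (f (OpMod.of _ (1 : ℂ)))) hr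
    simpa [u, OpMod.toLin] using this
  · have h2 := (coactOp_comm_iff (OpMod.toLin r)).1 (OpMod.toLin_comm r) x
    rw [← h2]
    simp [δ₁]

end Haar

/-! ### The expectation `A → A^{co H}` given by the Haar functional -/

section Expectation

variable {A : Type u} {H : Type v} [Ring A] [HopfAlgebra ℂ A] [Ring H] [HopfAlgebra ℂ H]

/-- A normalised functional with `x₍₁₎ h(x₍₂₎) = h(x) 1`. -/
structure IsHaar (h : Module.Dual ℂ H) : Prop where
  map_one : h 1 = 1
  invariant : ∀ x : H,
    TensorProduct.rid ℂ H (h.lTensor H (Coalgebra.comul (R := ℂ) x)) = h x • (1 : H)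

/-- The right `H`-coaction `(id ⊗ π) Δ` on `A`. -/
def rcoact (π : A →ₐc[ℂ] H) : A →ₐ[ℂ] A ⊗[ℂ] H :=
  (Algebra.TensorProduct.map (AlgHom.id ℂ A) (π : A →ₐ[ℂ] H)).comp (Bialgebra.comulAlgHom ℂ A)

theorem rcoact_apply (π : A →ₐc[ℂ] H) (a : A) :
    rcoact π a = (π : A →ₗ[ℂ] H).lTensor A (Coalgebra.comul (R := ℂ) a) := rfl

theorem rcoact_coinv (π : A →ₐc[ℂ] H) (b : coinv π) : rcoact π b = (b : A) ⊗ₜ[ℂ] (1 : H) := b.2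

theorem counit_hom (π : A →ₐc[ℂ] H) (a : A) :
    Coalgebra.counit (R := ℂ) (π a) = Coalgebra.counit (R := ℂ) a :=
  CoalgHomClass.counit_comp_apply π a

theorem comul_hom (π : A →ₐc[ℂ] H) (a : A) :
    Coalgebra.comul (R := ℂ) (π a) =
      TensorProduct.map (π : A →ₗ[ℂ] H) (π : A →ₗ[ℂ] H) (Coalgebra.comul (R := ℂ) a) :=
  (CoalgHomClass.map_comp_comul_apply π a).symm

/-- S ∘ π is a left and π ∘ S a right convolution inverse of π. -/
theorem antipode_hom (π : A →ₐc[ℂ] H) (a : A) :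
    HopfAlgebra.antipode ℂ (π a) = π (HopfAlgebra.antipode ℂ a) := by
  have h : (HopfAlgebra.antipode ℂ ∘ₗ (π : A →ₗ[ℂ] H)) =
      (π : A →ₗ[ℂ] H) ∘ₗ HopfAlgebra.antipode ℂ := by
    apply WithConv.toConv_injective
    apply left_inv_eq_right_inv (a := WithConv.toConv (π : A →ₗ[ℂ] H))
    · ext a
      have := HopfAlgebra.mul_antipode_rTensor_comul_apply (R := ℂ) (π a)
      rw [comul_hom, counit_hom] at this
      rw [LinearMap.convMul_apply]
      simp only [LinearMap.convOne_apply]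
      rw [← this]
      generalize Coalgebra.comul (R := ℂ) a = z
      induction z with
      | zero => simp
      | add s t hs ht => simp only [map_add, hs, ht]
      | tmul x y => simp
    · ext a
      have := congrArg π (HopfAlgebra.mul_antipode_lTensor_comul_apply (R := ℂ) a)
      rw [LinearMap.convMul_apply]
      simp only [LinearMap.convOne_apply]
      rw [AlgHomClass.commutes] at this
      rw [← this]
      generalize Coalgebra.comul (R := ℂ) a = z
      induction z with
      | zero => simp
      | add s t hs ht => simp only [map_add, hs, ht]
      | tmul x y => simp
  exact LinearMap.congr_fun h a

/-- Apply ε ⊗ id to b₍₁₎ ⊗ π(b₍₂₎) = b ⊗ 1. -/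
theorem hom_coinv (π : A →ₐc[ℂ] H) (b : coinv π) :
    π (b : A) = algebraMap ℂ H (Coalgebra.counit (R := ℂ) (b : A)) := by
  have h1 := congrArg (slice H (Coalgebra.counit (R := ℂ) (A := A))) (rcoact_coinv π b)
  rw [rcoact_apply, slice_lTensor, slice_tmul] at h1
  rw [Algebra.algebraMap_eq_smul_one, ← h1]
  refine congrArg π ?_
  change _ = (TensorProduct.lid ℂ A
    ((Coalgebra.counit (R := ℂ)).rTensor A (Coalgebra.comul (R := ℂ) (b : A))))
  rw [Coalgebra.rTensor_counit_comul]
  simp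

/-- `a ⊗ x ↦ h(x) a`. -/
def rslice (h : Module.Dual ℂ H) : A ⊗[ℂ] H →ₗ[ℂ] A :=
  (TensorProduct.rid ℂ A).toLinearMap ∘ₗ h.lTensor A

@[simp]
theorem rslice_tmul (h : Module.Dual ℂ H) (a : A) (x : H) : rslice h (a ⊗ₜ x) = h x • a := by
  simp [rslice]

theorem rslice_mul (h : Module.Dual ℂ H) (t : A ⊗[ℂ] H) (a : A) :
    rslice h (t * a ⊗ₜ[ℂ] (1 : H)) = rslice h t * a := by
  induction t with
  | zero => simp
  | add s t hs ht => simp only [add_mul, map_add, hs, ht]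
  | tmul x y => simp

/-- The right coaction sends a₍₁₎ h(π(a₍₂₎)) to a₍₁₎ ⊗ π(a₍₂₎) h(π(a₍₃₎)), and invariance of h
collapses the second leg to 1. -/
theorem rslice_rcoact_mem (π : A →ₐc[ℂ] H) {h : Module.Dual ℂ H} (hh : IsHaar h) (a : A) :
    rslice h (rcoact π a) ∈ coinv π := by
  change rcoact π _ = _ ⊗ₜ[ℂ] (1 : H)
  let L : A ⊗[ℂ] (A ⊗[ℂ] A) →ₗ[ℂ] A ⊗[ℂ] H :=
    ((TensorProduct.rid ℂ H).toLinearMap ∘ₗ TensorProduct.map (π : A →ₗ[ℂ] H)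
      (h ∘ₗ (π : A →ₗ[ℂ] H))).lTensor A
  have h1 : ∀ z : A ⊗[ℂ] A, rcoact π (rslice h ((π : A →ₗ[ℂ] H).lTensor A z)) =
      L (TensorProduct.assoc ℂ A A A ((Coalgebra.comul (R := ℂ)).rTensor A z)) := by
    intro z
    induction z with
    | zero => simp
    | add s t hs ht => simp only [map_add, hs, ht]
    | tmul x y =>
      simp only [LinearMap.lTensor_tmul, rslice_tmul, map_smul, LinearMap.rTensor_tmul,
        rcoact_apply]
      generalize Coalgebra.comul (R := ℂ) x = z
      induction z with
      | zero => simp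
      | add s t hs ht => simp only [map_add, TensorProduct.add_tmul, smul_add, hs, ht]
      | tmul p q => simp [L]
  have h2 : ∀ z : A ⊗[ℂ] A, L ((Coalgebra.comul (R := ℂ)).lTensor A z) =
      rslice h ((π : A →ₗ[ℂ] H).lTensor A z) ⊗ₜ[ℂ] (1 : H) := by
    intro z
    induction z with
    | zero => simp
    | add s t hs ht => simp only [map_add, TensorProduct.add_tmul, hs, ht]
    | tmul x y =>
      have h3 := hh.invariant (π y)
      rw [comul_hom] at h3
      simp only [LinearMap.lTensor_tmul, rslice_tmul, L, LinearMap.comp_apply,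
        LinearEquiv.coe_coe]
      rw [← TensorProduct.smul_tmul', ← TensorProduct.tmul_smul]
      congr 1
      refine Eq.trans ?_ h3
      congr 1
      rw [← LinearMap.comp_apply (h.lTensor H), LinearMap.lTensor_comp_map]
  have h3 := h1 (Coalgebra.comul a)
  rwa [Coalgebra.coassoc_apply, h2] at h3

/-- The expectation `a ↦ a₍₁₎ h(π(a₍₂₎))`. -/
def expect (π : A →ₐc[ℂ] H) {h : Module.Dual ℂ H} (hh : IsHaar h) : A →ₗ[ℂ] coinv π :=
  (rslice h ∘ₗ (rcoact π).toLinearMap).codRestrict (Subalgebra.toSubmodule (coinv π))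
    (rslice_rcoact_mem π hh)

variable (π : A →ₐc[ℂ] H) {h : Module.Dual ℂ H} (hh : IsHaar h)

theorem coe_expect (a : A) : (expect π hh a : A) = rslice h (rcoact π a) := rfl

/-- The right coaction is multiplicative and sends b to b ⊗ 1. This linearity is what lets
`preCounit` descend to the fibre. -/
theorem expect_mul_coinv (a : A) (b : coinv π) : expect π hh (a * b) = expect π hh a * b := by
  apply Subtype.ext
  rw [coe_expect, map_mul, rcoact_coinv, rslice_mul]
  rfl

theorem expect_one : expect π hh 1 = 1 := by
  apply Subtype.ext
  rw [coe_expect, map_one, Algebra.TensorProduct.one_def, rslice_tmul, hh.map_one, one_smul]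
  rfl

end Expectation

/-! ### Cancellation in comodules -/

section Cancel

variable {A : Type u} [Ring A] [HopfAlgebra ℂ A] {M : Type*} [AddCommGroup M] [Module ℂ M]
  {δ : M →ₗ[ℂ] A ⊗[ℂ] M}

theorem rTensor_coassoc {Y : Type*} [AddCommGroup Y] [Module ℂ Y] (D : A ⊗[ℂ] A →ₗ[ℂ] Y)
    (coassoc : ∀ m, TensorProduct.assoc ℂ A A M
      ((Coalgebra.comul (R := ℂ)).rTensor M (δ m)) = δ.lTensor A (δ m)) (m : M) :
    D.rTensor M ((TensorProduct.assoc ℂ A A M).symm (δ.lTensor A (δ m))) =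
      (D ∘ₗ Coalgebra.comul).rTensor M (δ m) := by
  rw [← coassoc, LinearEquiv.symm_apply_apply, LinearMap.rTensor_comp, LinearMap.comp_apply]

/-- By coassociativity, D applied to m₍₋₂₎ ⊗ m₍₋₁₎ is D ∘ Δ applied to m₍₋₁₎. The intended D is a ⊗
c ↦ a S(c). -/
theorem rTensor_coassoc_of_counit (D : A ⊗[ℂ] A →ₗ[ℂ] A)
    (hD : ∀ a, D (Coalgebra.comul a) = algebraMap ℂ A (Coalgebra.counit a))
    (coassoc : ∀ m, TensorProduct.assoc ℂ A A M
      ((Coalgebra.comul (R := ℂ)).rTensor M (δ m)) = δ.lTensor A (δ m))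
    (counit : ∀ m,
      TensorProduct.lid ℂ M ((Coalgebra.counit (R := ℂ)).rTensor M (δ m)) = m) (m : M) :
    D.rTensor M ((TensorProduct.assoc ℂ A A M).symm (δ.lTensor A (δ m))) = 1 ⊗ₜ m := by
  have h1 : D ∘ₗ Coalgebra.comul = Algebra.linearMap ℂ A ∘ₗ Coalgebra.counit :=
    LinearMap.ext hD
  rw [rTensor_coassoc D coassoc, h1]
  conv_rhs => rw [← counit m]
  generalize δ m = z
  induction z with
  | zero => simp
  | add s t hs ht => simp only [map_add, TensorProduct.tmul_add, hs, ht]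
  | tmul a m => simp [Algebra.algebraMap_eq_smul_one, TensorProduct.smul_tmul]

end Cancel

/-! ### Antipode identities relating the expectation and the right coaction. -/

section Expectation

variable {A : Type u} {H : Type v} [Ring A] [HopfAlgebra ℂ A] [Ring H] [HopfAlgebra ℂ H]
  (π : A →ₐc[ℂ] H) {h : Module.Dual ℂ H} (hh : IsHaar h)

/-- `a ⊗ c ↦ a S(c)`. -/
def mulAntipode (A : Type u) [Ring A] [HopfAlgebra ℂ A] : A ⊗[ℂ] A →ₗ[ℂ] A :=
  LinearMap.mul' ℂ A ∘ₗ (HopfAlgebra.antipode ℂ).lTensor A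

/-- `a ⊗ c ↦ S(a) c`. -/
def antipodeMul (A : Type u) [Ring A] [HopfAlgebra ℂ A] : A ⊗[ℂ] A →ₗ[ℂ] A :=
  LinearMap.mul' ℂ A ∘ₗ (HopfAlgebra.antipode ℂ).rTensor A

@[simp]
theorem mulAntipode_tmul (a c : A) :
    mulAntipode A (a ⊗ₜ c) = a * HopfAlgebra.antipode ℂ c := by
  simp [mulAntipode]

@[simp]
theorem antipodeMul_tmul (a c : A) :
    antipodeMul A (a ⊗ₜ c) = HopfAlgebra.antipode ℂ a * c := by
  simp [antipodeMul]

theorem mulAntipode_comul (a : A) :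
    mulAntipode A (Coalgebra.comul a) = algebraMap ℂ A (Coalgebra.counit a) :=
  HopfAlgebra.mul_antipode_lTensor_comul_apply a

theorem antipodeMul_comul (a : A) :
    antipodeMul A (Coalgebra.comul a) = algebraMap ℂ A (Coalgebra.counit a) :=
  HopfAlgebra.mul_antipode_rTensor_comul_apply a

/-- `a ⊗ x ↦ a₍₁₎ h(π(a₍₂₎) S(x))`. -/
def twist (h : Module.Dual ℂ H) : A ⊗[ℂ] H →ₗ[ℂ] A :=
  rslice h ∘ₗ LinearMap.mul' ℂ (A ⊗[ℂ] H) ∘ₗ TensorProduct.map (rcoact π).toLinearMap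
    ((TensorProduct.mk ℂ A H 1) ∘ₗ HopfAlgebra.antipode ℂ)

theorem twist_tmul (h : Module.Dual ℂ H) (a : A) (x : H) :
    twist π h (a ⊗ₜ x) =
      rslice h (rcoact π a * (1 : A) ⊗ₜ[ℂ] (HopfAlgebra.antipode ℂ x : H)) := by
  simp [twist]

/-- The left side is c₍₁₎ ⊗ π(c₍₂₎ S(c₍₃₎)), and the antipode axiom cancels the last two legs. -/
theorem rcoact_mul_antipode (c : A) :
    (LinearMap.mul' ℂ (A ⊗[ℂ] H) ∘ₗ TensorProduct.map (rcoact π).toLinearMap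
      ((TensorProduct.mk ℂ A H 1) ∘ₗ HopfAlgebra.antipode ℂ ∘ₗ (π : A →ₗ[ℂ] H)))
      (Coalgebra.comul (R := ℂ) c) = c ⊗ₜ[ℂ] (1 : H) := by
  let L : A ⊗[ℂ] (A ⊗[ℂ] A) →ₗ[ℂ] A ⊗[ℂ] H :=
    ((π : A →ₗ[ℂ] H) ∘ₗ mulAntipode A).lTensor A
  have h1 : ∀ z : A ⊗[ℂ] A, (LinearMap.mul' ℂ (A ⊗[ℂ] H) ∘ₗ TensorProduct.map
      (rcoact π).toLinearMap
      ((TensorProduct.mk ℂ A H 1) ∘ₗ HopfAlgebra.antipode ℂ ∘ₗ (π : A →ₗ[ℂ] H))) z =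
      L (TensorProduct.assoc ℂ A A A ((Coalgebra.comul (R := ℂ)).rTensor A z)) := by
    intro z
    induction z with
    | zero => simp
    | add s t hs ht => simp only [map_add, hs, ht]
    | tmul x y =>
      simp only [LinearMap.comp_apply, TensorProduct.map_tmul, LinearMap.mul'_apply,
        AlgHom.toLinearMap_apply, rcoact_apply, LinearMap.rTensor_tmul]
      generalize Coalgebra.comul (R := ℂ) x = z
      induction z with
      | zero => simp
      | add s t hs ht => simp only [map_add, TensorProduct.add_tmul, add_mul, hs, ht]
      | tmul p q => simp [L, antipode_hom]
  have h2 : ∀ z : A ⊗[ℂ] A, L ((Coalgebra.comul (R := ℂ)).lTensor A z) =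
      TensorProduct.rid ℂ A ((Coalgebra.counit (R := ℂ)).lTensor A z) ⊗ₜ[ℂ] (1 : H) := by
    intro z
    induction z with
    | zero => simp
    | add s t hs ht => simp only [map_add, TensorProduct.add_tmul, hs, ht]
    | tmul x y =>
      simp [L, mulAntipode_comul, Algebra.algebraMap_eq_smul_one, TensorProduct.smul_tmul]
  rw [h1, Coalgebra.coassoc_apply, h2, Coalgebra.lTensor_counit_comul]
  simp

/-- For normalised h this says that `twist` retracts the right coaction. -/
theorem twist_comul (c : A) :
    (twist π h ∘ₗ (π : A →ₗ[ℂ] H).lTensor A) (Coalgebra.comul (R := ℂ) c) = h 1 • c := by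
  rw [← rslice_tmul, ← rcoact_mul_antipode π]
  generalize Coalgebra.comul (R := ℂ) c = z
  induction z with
  | zero => simp
  | add s t hs ht => simp only [map_add, hs, ht]
  | tmul p q => simp [twist_tmul]

/-- `a ⊗ c ↦ E(a S(c₍₁₎)) c₍₂₎`. -/
def expectCancel : A ⊗[ℂ] A →ₗ[ℂ] A :=
  LinearMap.mul' ℂ A ∘ₗ ((Subalgebra.toSubmodule (coinv π)).subtype ∘ₗ expect π hh ∘ₗ
    mulAntipode A).rTensor A ∘ₗ (TensorProduct.assoc ℂ A A A).symm.toLinearMap ∘ₗ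
    Coalgebra.comul.lTensor A

/-- Expand c₍₂₎ ⊗ 1 by `rcoact_mul_antipode` and merge the two coactions by multiplicativity;
S(c₍₁₎) c₍₂₎ then cancels and only 1 ⊗ S(π(c)) is left. -/
theorem rcoact_antipode_mul (c : A) :
    (LinearMap.mul' ℂ (A ⊗[ℂ] H) ∘ₗ TensorProduct.map
      ((rcoact π).toLinearMap ∘ₗ HopfAlgebra.antipode ℂ) ((TensorProduct.mk ℂ A H).flip 1))
      (Coalgebra.comul (R := ℂ) c) = (1 : A) ⊗ₜ[ℂ] (HopfAlgebra.antipode ℂ (π c) : H) := by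
  let Φ : A ⊗[ℂ] A →ₗ[ℂ] A ⊗[ℂ] H :=
    LinearMap.mul' ℂ (A ⊗[ℂ] H) ∘ₗ TensorProduct.map (rcoact π).toLinearMap
      ((TensorProduct.mk ℂ A H 1) ∘ₗ HopfAlgebra.antipode ℂ ∘ₗ (π : A →ₗ[ℂ] H))
  let L : A ⊗[ℂ] (A ⊗[ℂ] A) →ₗ[ℂ] A ⊗[ℂ] H :=
    LinearMap.mul' ℂ (A ⊗[ℂ] H) ∘ₗ TensorProduct.map
      ((rcoact π).toLinearMap ∘ₗ HopfAlgebra.antipode ℂ) Φ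
  have h1 : ∀ z : A ⊗[ℂ] A, (LinearMap.mul' ℂ (A ⊗[ℂ] H) ∘ₗ TensorProduct.map
      ((rcoact π).toLinearMap ∘ₗ HopfAlgebra.antipode ℂ) ((TensorProduct.mk ℂ A H).flip 1)) z =
      L (Coalgebra.comul.lTensor A z) := by
    intro z
    induction z with
    | zero => simp
    | add s t hs ht => simp only [map_add, hs, ht]
    | tmul x y =>
      have := rcoact_mul_antipode π y
      simp only [L, LinearMap.lTensor_tmul, LinearMap.comp_apply, TensorProduct.map_tmul, Φ] at *
      rw [this]
      rfl
  have h2 : ∀ z : A ⊗[ℂ] A,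
      L (TensorProduct.assoc ℂ A A A ((Coalgebra.comul (R := ℂ)).rTensor A z)) =
      (1 : A) ⊗ₜ[ℂ] (HopfAlgebra.antipode ℂ
        (π (TensorProduct.lid ℂ A ((Coalgebra.counit (R := ℂ)).rTensor A z))) : H) := by
    intro z
    induction z with
    | zero => simp
    | add s t hs ht => simp only [map_add, TensorProduct.tmul_add, hs, ht]
    | tmul x y =>
      have h3 : ∀ z : A ⊗[ℂ] A, L (TensorProduct.assoc ℂ A A A (z ⊗ₜ y)) =
          rcoact π (antipodeMul A z) * (1 : A) ⊗ₜ[ℂ] (HopfAlgebra.antipode ℂ (π y) : H) := by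
        intro z
        induction z with
        | zero => simp
        | add s t hs ht => simp only [map_add, TensorProduct.add_tmul, add_mul, hs, ht]
        | tmul p q => simp [L, Φ, mul_assoc]
      rw [LinearMap.rTensor_tmul, h3, antipodeMul_comul, AlgHom.commutes]
      simp [Algebra.algebraMap_eq_smul_one]
  rw [h1, ← Coalgebra.coassoc_apply, h2, Coalgebra.rTensor_counit_comul]
  simp

/-- Pull c₍₂₎ inside the slice as c₍₂₎ ⊗ 1 and use `rcoact_antipode_mul`. The point is that E(a
S(c₍₁₎)) c₍₂₎ depends on c only through π(c), hence can be expressed by the H-coaction on a fibre.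
-/
theorem expectCancel_eq : expectCancel π hh = twist π h ∘ₗ (π : A →ₗ[ℂ] H).lTensor A := by
  refine TensorProduct.ext' fun a c => ?_
  simp only [LinearMap.comp_apply, LinearMap.lTensor_tmul, twist_tmul, LinearMap.coe_coe]
  rw [← rcoact_antipode_mul, expectCancel]
  simp only [LinearMap.comp_apply, LinearMap.lTensor_tmul]
  generalize Coalgebra.comul (R := ℂ) c = z
  induction z with
  | zero => simp
  | add s t hs ht => simp only [map_add, TensorProduct.tmul_add, mul_add, hs, ht]
  | tmul p q =>
    have := rslice_mul h (rcoact π (a * HopfAlgebra.antipode ℂ p)) q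
    simp only [map_mul, mul_assoc] at this
    simp [this]
    exact congrArg (fun t => rslice h t * q) (map_mul (rcoact π) _ _)

end Expectation

namespace RelHopfModule

theorem lTensor_rTensor_comm {A A' X Y : Type*} [AddCommGroup A] [Module ℂ A] [AddCommGroup A']
    [Module ℂ A'] [AddCommGroup X] [Module ℂ X] [AddCommGroup Y] [Module ℂ Y] (f : X →ₗ[ℂ] Y)
    (g : A →ₗ[ℂ] A') (t : A ⊗[ℂ] X) :
    f.lTensor A' (g.rTensor X t) = g.rTensor Y (f.lTensor A t) := by
  induction t with
  | zero => simp
  | add s t hs ht => simp only [map_add, hs, ht]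
  | tmul a x => simp

/-! ### The fibre `M / B⁺ M` -/

section Fibre

variable {A : Type u} {H : Type v} [Ring A] [HopfAlgebra ℂ A] [Ring H] [HopfAlgebra ℂ H]
  {π : A →ₐc[ℂ] H} (M N : RelHopfModule π)

/-- The subspace `B⁺ M`. -/
def aug : Submodule ℂ M :=
  Submodule.span ℂ {x : M | ∃ (b : coinv π) (m : M),
    Coalgebra.counit (R := ℂ) (b : A) = 0 ∧ x = b • m}

/-- The fibre `M / B⁺ M`. -/
abbrev Fibre : Type u := M ⧸ M.aug

/-- The projection to the fibre. -/
def toFibre : M →ₗ[ℂ] M.Fibre := M.aug.mkQ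

theorem toFibre_surjective : Function.Surjective M.toFibre := M.aug.mkQ_surjective

variable {M N}

theorem toFibre_eq_zero {m : M} : M.toFibre m = 0 ↔ m ∈ M.aug := Submodule.Quotient.mk_eq_zero _

theorem toFibre_lsmul (b : coinv π) (m : M) :
    M.toFibre (b • m) = Coalgebra.counit (R := ℂ) (b : A) • M.toFibre m := by
  rw [← map_smul, ← sub_eq_zero, ← map_sub, toFibre_eq_zero]
  refine Submodule.subset_span
    ⟨b - algebraMap ℂ (coinv π) (Coalgebra.counit (R := ℂ) (b : A)), m, ?_, ?_⟩
  · change Coalgebra.counit (R := ℂ) ((b : A) - algebraMap ℂ A _) = 0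
    rw [map_sub, Bialgebra.counit_algebraMap, sub_self]
  · rw [sub_smul, algebraMap_smul]

/-- The element m(b − ε(b)) lies in MB⁺ = B⁺M. -/
theorem toFibre_rsmul (hM : M.IsModZero) (b : coinv π) (m : M) :
    M.toFibre (MulOpposite.op b • m) = Coalgebra.counit (R := ℂ) (b : A) • M.toFibre m := by
  rw [← map_smul, ← sub_eq_zero, ← map_sub, toFibre_eq_zero, aug, ← hM.comm_aug]
  refine Submodule.subset_span
    ⟨b - algebraMap ℂ (coinv π) (Coalgebra.counit (R := ℂ) (b : A)), m, ?_, ?_⟩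
  · change Coalgebra.counit (R := ℂ) ((b : A) - algebraMap ℂ A _) = 0
    rw [map_sub, Bialgebra.counit_algebraMap, sub_self]
  · rw [MulOpposite.op_sub, sub_smul, ← algebraMap_smul (coinv π)ᵐᵒᵖ]
    rfl

theorem lTensor_coinvCoact (b : coinv π) :
    (Subalgebra.toSubmodule (coinv π)).subtype.lTensor A (coinvCoact π b) =
      Coalgebra.comul (R := ℂ) (b : A) :=
  lTensor_restrictCoact A Coalgebra.comul _ (comul_mem_of_coinv π) b

variable (M) in
/-- The map `M → A ⊗ M / B⁺ M`, `m ↦ m₍₋₁₎ ⊗ [m₍₀₎]`. -/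
def unit : M →ₗ[ℂ] A ⊗[ℂ] M.Fibre := M.toFibre.lTensor A ∘ₗ M.coact

/-- In b₍₁₎ m₍₋₁₎ ⊗ [b₍₂₎ m₍₀₎] the second leg of Δ(b) acts on the fibre by ε. -/
theorem unit_lsmul (b : coinv π) (m : M) :
    M.unit (b • m) = (LinearMap.mulLeft ℂ (b : A)).rTensor M.Fibre (M.unit m) := by
  have key : ∀ (x : A ⊗[ℂ] coinv π) (t : A ⊗[ℂ] M), M.toFibre.lTensor A
      (TensorProduct.map₂ (LinearMap.mul ℂ A) (lactLin (coinv π) M) x t) =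
      (LinearMap.mulLeft ℂ (TensorProduct.rid ℂ A ((Coalgebra.counit (R := ℂ)).lTensor A
        ((Subalgebra.toSubmodule (coinv π)).subtype.lTensor A x)))).rTensor M.Fibre
        (M.toFibre.lTensor A t) := by
    intro x t
    induction t with
    | zero => simp
    | add s t hs ht => simp only [map_add, hs, ht]
    | tmul a m =>
      induction x with
      | zero => simp
      | add s t hs ht =>
        simp only [map_add, LinearMap.add_apply, hs, ht]
        simp [add_mul, TensorProduct.add_tmul]
      | tmul c b =>
        have : lactLin (coinv π) M b m = b • m := rfl
        simp only [TensorProduct.map₂_apply_tmul, TensorProduct.map_tmul, LinearMap.lTensor_tmul,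
          this, toFibre_lsmul]
        simp [TensorProduct.smul_tmul']
  rw [unit, LinearMap.comp_apply, LinearMap.comp_apply, M.coact_lsmul, key, lTensor_coinvCoact,
    Coalgebra.lTensor_counit_comul]
  simp

theorem unit_rsmul (hM : M.IsModZero) (b : coinv π) (m : M) :
    M.unit (MulOpposite.op b • m) =
      (LinearMap.mulRight ℂ (b : A)).rTensor M.Fibre (M.unit m) := by
  have key : ∀ (x : A ⊗[ℂ] coinv π) (t : A ⊗[ℂ] M), M.toFibre.lTensor A
      (TensorProduct.map₂ (LinearMap.mul ℂ A) (ractLin (coinv π) M) t x) =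
      (LinearMap.mulRight ℂ (TensorProduct.rid ℂ A ((Coalgebra.counit (R := ℂ)).lTensor A
        ((Subalgebra.toSubmodule (coinv π)).subtype.lTensor A x)))).rTensor M.Fibre
        (M.toFibre.lTensor A t) := by
    intro x t
    induction t with
    | zero => simp
    | add s t hs ht => simp only [map_add, LinearMap.add_apply, hs, ht]
    | tmul a m =>
      induction x with
      | zero => simp
      | add s t hs ht =>
        simp only [map_add, hs, ht]
        simp [mul_add, TensorProduct.add_tmul]
      | tmul c b =>
        have : ractLin (coinv π) M m b = MulOpposite.op b • m := rfl
        simp only [TensorProduct.map₂_apply_tmul, TensorProduct.map_tmul, LinearMap.lTensor_tmul,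
          this, toFibre_rsmul hM]
        simp [TensorProduct.smul_tmul']
  rw [unit, LinearMap.comp_apply, LinearMap.comp_apply, M.coact_rsmul, key, lTensor_coinvCoact,
    Coalgebra.lTensor_counit_comul]
  simp

variable (M) in
/-- The left `H`-coaction on the fibre, `[m] ↦ π(m₍₋₁₎) ⊗ [m₍₀₎]`. -/
def fibreCoact : M.Fibre →ₗ[ℂ] H ⊗[ℂ] M.Fibre :=
  M.aug.liftQ ((π : A →ₗ[ℂ] H).rTensor M.Fibre ∘ₗ M.unit) (by
    refine Submodule.span_le.2 ?_
    rintro _ ⟨b, m, hb, rfl⟩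
    change (π : A →ₗ[ℂ] H).rTensor M.Fibre (M.unit (b • m)) = 0
    -- Now b only multiplies the leg in A, and π(b) = ε(b) 1 = 0.
    rw [unit_lsmul]
    generalize M.unit m = t
    induction t with
    | zero => simp
    | add s t hs ht => simp only [map_add, hs, ht, add_zero]
    | tmul a m => simp [hom_coinv, hb])

theorem fibreCoact_toFibre (m : M) :
    M.fibreCoact (M.toFibre m) = (π : A →ₗ[ℂ] H).rTensor M.Fibre (M.unit m) := rfl

theorem fibreCoact_counit (x : M.Fibre) : slice M.Fibre Coalgebra.counit (M.fibreCoact x) = x := by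
  obtain ⟨m, rfl⟩ := M.toFibre_surjective x
  rw [fibreCoact_toFibre, unit, LinearMap.comp_apply]
  conv_rhs => rw [← M.counit_coact m]
  generalize M.coact m = t
  induction t with
  | zero => simp
  | add s t hs ht => simp only [map_add, hs, ht]
  | tmul a m => simp

theorem toFibre_eq_counit_unit (m : M) :
    slice M.Fibre Coalgebra.counit (M.unit m) = M.toFibre m := by
  rw [unit, LinearMap.comp_apply, slice_lTensor]
  exact congrArg _ (M.counit_coact m)

theorem fibreCoact_lTensor (m : M) :
    M.fibreCoact.lTensor A (M.unit m) =
      ((π : A →ₗ[ℂ] H).rTensor M.Fibre ∘ₗ M.toFibre.lTensor A).lTensor A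
        (M.coact.lTensor A (M.coact m)) := by
  rw [unit, LinearMap.comp_apply]
  generalize M.coact m = t
  induction t with
  | zero => simp
  | add s t hs ht => simp only [map_add, hs, ht]
  | tmul a m =>
    simp only [LinearMap.lTensor_tmul, fibreCoact_toFibre, unit, LinearMap.comp_apply]

theorem fibreCoact_coassoc (x : M.Fibre) : TensorProduct.assoc ℂ H H M.Fibre
    ((Coalgebra.comul (R := ℂ)).rTensor M.Fibre (M.fibreCoact x)) =
      M.fibreCoact.lTensor H (M.fibreCoact x) := by
  obtain ⟨m, rfl⟩ := M.toFibre_surjective x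
  have h1 : ∀ t : A ⊗[ℂ] M.Fibre, M.fibreCoact.lTensor H ((π : A →ₗ[ℂ] H).rTensor M.Fibre t) =
      (π : A →ₗ[ℂ] H).rTensor _ (M.fibreCoact.lTensor A t) := by
    intro t
    induction t with
    | zero => simp
    | add s t hs ht => simp only [map_add, hs, ht]
    | tmul a m => simp
  rw [fibreCoact_toFibre, h1, fibreCoact_lTensor, ← M.coassoc, unit, LinearMap.comp_apply]
  generalize M.coact m = t
  induction t with
  | zero => simp
  | add s t hs ht => simp only [map_add, hs, ht]
  | tmul a m =>
    simp only [LinearMap.lTensor_tmul, LinearMap.rTensor_tmul, LinearMap.coe_coe, comul_hom]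
    generalize Coalgebra.comul (R := ℂ) a = t
    induction t with
    | zero => simp
    | add s t hs ht => simp only [map_add, TensorProduct.add_tmul, hs, ht]
    | tmul a m => simp

end Fibre

/-! ### The inverse of the unit, lifting of colinear maps of the fibres -/

section Lift

variable {A : Type u} {H : Type v} [Ring A] [HopfAlgebra ℂ A] [Ring H] [HopfAlgebra ℂ H]
  {π : A →ₐc[ℂ] H} {h : Module.Dual ℂ H} (hh : IsHaar h) (M : RelHopfModule π)

/-- `a ⊗ m ↦ E(a S(m₍₋₁₎)) m₍₀₎`. -/
def preCounit : A ⊗[ℂ] M →ₗ[ℂ] M :=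
  TensorProduct.lift (lactLin (coinv π) M) ∘ₗ (expect π hh ∘ₗ mulAntipode A).rTensor M ∘ₗ
    (TensorProduct.assoc ℂ A A M).symm.toLinearMap ∘ₗ M.coact.lTensor A

variable {M}

/-- By right B-linearity of E, E(a S(b₍₁₎ m₍₋₁₎)) b₍₂₎ m₍₀₎ = E(a S(m₍₋₁₎) S(b₍₁₎) b₍₂₎) m₍₀₎, which
carries the factor ε(b). -/
theorem preCounit_lsmul (a : A) (b : coinv π) (m : M) (hb : Coalgebra.counit (R := ℂ) (b : A) = 0) :
    preCounit hh M (a ⊗ₜ (b • m)) = 0 := by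
  have key : ∀ (x : A ⊗[ℂ] coinv π) (c : A) (n : M),
      TensorProduct.lift (lactLin (coinv π) M) ((expect π hh ∘ₗ mulAntipode A).rTensor M
        ((TensorProduct.assoc ℂ A A M).symm (a ⊗ₜ
          (TensorProduct.map₂ (LinearMap.mul ℂ A) (lactLin (coinv π) M) x (c ⊗ₜ n))))) =
      expect π hh (a * HopfAlgebra.antipode ℂ c * antipodeMul A
        ((Subalgebra.toSubmodule (coinv π)).subtype.lTensor A x)) • n := by
    intro x c n
    induction x with
    | zero => simp
    | add s t hs ht =>
      simp only [map_add, LinearMap.add_apply, TensorProduct.tmul_add, mul_add, add_smul, hs, ht]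
    | tmul c' b' =>
      have h1 : ∀ m : M, lactLin (coinv π) M b' m = b' • m := fun _ => rfl
      have h2 : ∀ (b : coinv π) (m : M), lactLin (coinv π) M b m = b • m := fun _ _ => rfl
      simp only [TensorProduct.map₂_apply_tmul, TensorProduct.map_tmul, h2,
        TensorProduct.assoc_symm_tmul, LinearMap.rTensor_tmul, TensorProduct.lift.tmul,
        LinearMap.comp_apply, mulAntipode_tmul, LinearMap.mul_apply', LinearMap.lTensor_tmul,
        antipodeMul_tmul, HopfAlgebra.antipode_mul_antidistrib, smul_smul, ← expect_mul_coinv]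
      simp only [mul_assoc]
      rfl
  simp only [preCounit, LinearMap.comp_apply, LinearMap.lTensor_tmul, M.coact_lsmul,
    LinearEquiv.coe_coe]
  generalize M.coact m = t
  induction t with
  | zero => simp
  | add s t hs ht => simp only [map_add, TensorProduct.tmul_add, hs, ht, add_zero]
  | tmul c n => rw [key, lTensor_coinvCoact, antipodeMul_comul, hb]; simp

variable (M) in
/-- `a ⊗ [m] ↦ E(a S(m₍₋₁₎)) m₍₀₎`. -/
def counit' : A ⊗[ℂ] M.Fibre →ₗ[ℂ] M :=
  TensorProduct.lift (LinearMap.flip (M.aug.liftQ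
    (LinearMap.flip (TensorProduct.curry (preCounit hh M))) (by
      refine Submodule.span_le.2 ?_
      rintro _ ⟨b, m, hb, rfl⟩
      ext a
      exact preCounit_lsmul hh a b m hb)))

theorem counit'_lTensor (t : A ⊗[ℂ] M) : counit' hh M (M.toFibre.lTensor A t) = preCounit hh M t := by
  induction t with
  | zero => simp
  | add s t hs ht => simp only [map_add, hs, ht]
  | tmul a m => rfl

/-- E(m₍₋₂₎ S(m₍₋₁₎)) m₍₀₎ = E(1) m = m. -/
theorem counit'_unit (m : M) : counit' hh M (M.unit m) = m := by
  rw [unit, LinearMap.comp_apply, counit'_lTensor, preCounit, LinearMap.comp_apply,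
    LinearMap.comp_apply, LinearMap.comp_apply, LinearMap.rTensor_comp, LinearMap.comp_apply,
    LinearEquiv.coe_coe,
    rTensor_coassoc_of_counit _ mulAntipode_comul M.coassoc M.counit_coact]
  simp [expect_one, lactLin]

theorem unit_injective {h : Module.Dual ℂ H} (hh : IsHaar h) : Function.Injective M.unit :=
  Function.LeftInverse.injective (counit'_unit hh)

/-- Left linearity of `unit` gives E(a S(m₍₋₂₎)) m₍₋₁₎ ⊗ [m₍₀₎], and `expectCancel_eq` rewrites the
first leg. The idempotent onto the image of `unit` is thus described by the fibre coaction alone. -/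
theorem unit_counit' (t : A ⊗[ℂ] M.Fibre) : M.unit (counit' hh M t) =
    (twist π h).rTensor M.Fibre
      ((TensorProduct.assoc ℂ A H M.Fibre).symm (M.fibreCoact.lTensor A t)) := by
  induction t with
  | zero => simp
  | add s t hs ht => simp only [map_add, hs, ht]
  | tmul a x =>
    obtain ⟨m, rfl⟩ := M.toFibre_surjective x
    let D : A ⊗[ℂ] A →ₗ[ℂ] A := LinearMap.mul' ℂ A ∘ₗ
      ((Subalgebra.toSubmodule (coinv π)).subtype ∘ₗ expect π hh ∘ₗ LinearMap.mulLeft ℂ a ∘ₗ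
        HopfAlgebra.antipode ℂ).rTensor A
    have hD : D ∘ₗ Coalgebra.comul = twist π h ∘ₗ (TensorProduct.mk ℂ A H a) ∘ₗ
        (π : A →ₗ[ℂ] H) := by
      ext c
      have := LinearMap.congr_fun (expectCancel_eq π hh) (a ⊗ₜ c)
      simp only [LinearMap.comp_apply, LinearMap.lTensor_tmul] at this
      simp only [LinearMap.comp_apply, TensorProduct.mk_apply]
      rw [← this, expectCancel]
      simp only [LinearMap.comp_apply, LinearMap.lTensor_tmul]
      generalize Coalgebra.comul (R := ℂ) c = z
      induction z with
      | zero => simp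
      | add s t hs ht => simp only [map_add, TensorProduct.tmul_add, hs, ht]
      | tmul p q => simp [D]
    have h1 : ∀ z : A ⊗[ℂ] M, M.unit (TensorProduct.lift (lactLin (coinv π) M)
        ((expect π hh ∘ₗ mulAntipode A).rTensor M
          ((TensorProduct.assoc ℂ A A M).symm (a ⊗ₜ z)))) =
        M.toFibre.lTensor A (D.rTensor M ((TensorProduct.assoc ℂ A A M).symm
          (M.coact.lTensor A z))) := by
      intro z
      induction z with
      | zero => simp
      | add s t hs ht => simp only [map_add, TensorProduct.tmul_add, hs, ht]
      | tmul c n =>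
        have h2 : ∀ (b : coinv π) (m : M), lactLin (coinv π) M b m = b • m := fun _ _ => rfl
        simp only [TensorProduct.assoc_symm_tmul, LinearMap.rTensor_tmul,
          TensorProduct.lift.tmul, h2, unit_lsmul, LinearMap.lTensor_tmul]
        simp only [unit, LinearMap.comp_apply]
        generalize M.coact n = z
        induction z with
        | zero => simp
        | add s t hs ht => simp only [map_add, TensorProduct.tmul_add, hs, ht]
        | tmul p q => simp [D]
    have h3 := counit'_lTensor hh (a ⊗ₜ[ℂ] m)
    rw [LinearMap.lTensor_tmul] at h3
    rw [h3, preCounit]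
    simp only [LinearMap.comp_apply, LinearMap.lTensor_tmul, LinearEquiv.coe_coe]
    rw [h1, rTensor_coassoc D M.coassoc, hD, fibreCoact_toFibre, unit, LinearMap.comp_apply]
    generalize M.coact m = z
    induction z with
    | zero => simp
    | add s t hs ht => simp only [map_add, TensorProduct.tmul_add, hs, ht]
    | tmul p q => simp

/-- The lift of a linear map `f` of the fibres. -/
def liftLin {M N : RelHopfModule π} (f : M.Fibre →ₗ[ℂ] N.Fibre) : M →ₗ[ℂ] N :=
  counit' hh N ∘ₗ f.lTensor A ∘ₗ M.unit

/-- The idempotent of `unit_counit'` commutes with id ⊗ f because f is colinear, and it fixes the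
image of `unit` by `twist_comul`. -/
theorem unit_liftLin {M N : RelHopfModule π} (f : M.Fibre →ₗ[ℂ] N.Fibre)
    (hf : ∀ x, N.fibreCoact (f x) = f.lTensor H (M.fibreCoact x)) (m : M) :
    N.unit (liftLin hh f m) = f.lTensor A (M.unit m) := by
  have h1 : ∀ t : A ⊗[ℂ] M.Fibre, (twist π h).rTensor N.Fibre
      ((TensorProduct.assoc ℂ A H N.Fibre).symm (N.fibreCoact.lTensor A (f.lTensor A t))) =
      f.lTensor A ((twist π h).rTensor M.Fibre
        ((TensorProduct.assoc ℂ A H M.Fibre).symm (M.fibreCoact.lTensor A t))) := by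
    intro t
    induction t with
    | zero => simp
    | add s t hs ht => simp only [map_add, hs, ht]
    | tmul a x =>
      simp only [LinearMap.lTensor_tmul, hf]
      generalize M.fibreCoact x = z
      induction z with
      | zero => simp
      | add s t hs ht => simp only [map_add, TensorProduct.tmul_add, hs, ht]
      | tmul p q => simp
  have h2 : ∀ t : A ⊗[ℂ] (A ⊗[ℂ] M), (twist π h).rTensor M.Fibre
      ((TensorProduct.assoc ℂ A H M.Fibre).symm
        (((π : A →ₗ[ℂ] H).rTensor M.Fibre ∘ₗ M.toFibre.lTensor A).lTensor A t)) =
      M.toFibre.lTensor A ((twist π h ∘ₗ (π : A →ₗ[ℂ] H).lTensor A).rTensor M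
        ((TensorProduct.assoc ℂ A A M).symm t)) := by
    intro t
    induction t with
    | zero => simp
    | add s t hs ht => simp only [map_add, hs, ht]
    | tmul a t =>
      induction t with
      | zero => simp
      | add s t hs ht => simp only [map_add, TensorProduct.tmul_add, hs, ht]
      | tmul p q => simp
  have h3 : (twist π h ∘ₗ (π : A →ₗ[ℂ] H).lTensor A) ∘ₗ Coalgebra.comul = LinearMap.id := by
    ext c
    rw [LinearMap.comp_apply, twist_comul, hh.map_one, one_smul, LinearMap.id_apply]
  rw [liftLin, LinearMap.comp_apply, LinearMap.comp_apply, unit_counit', h1, fibreCoact_lTensor,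
    h2, rTensor_coassoc _ M.coassoc, h3, LinearMap.rTensor_id, LinearMap.id_apply, unit,
    LinearMap.comp_apply]

theorem toFibre_liftLin {M N : RelHopfModule π} (f : M.Fibre →ₗ[ℂ] N.Fibre)
    (hf : ∀ x, N.fibreCoact (f x) = f.lTensor H (M.fibreCoact x)) (m : M) :
    N.toFibre (liftLin hh f m) = f (M.toFibre m) := by
  rw [← toFibre_eq_counit_unit, unit_liftLin hh f hf, slice_lTensor, toFibre_eq_counit_unit]

/-- The lift of a colinear map of the fibres to a morphism of relative Hopf modules. -/
def liftHom {M N : RelHopfModule π} (hM : M.IsModZero) (hN : N.IsModZero)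
    (f : M.Fibre →ₗ[ℂ] N.Fibre)
    (hf : ∀ x, N.fibreCoact (f x) = f.lTensor H (M.fibreCoact x)) : Hom M N where
  toLin := liftLin hh f
  map_lsmul b m := by
    -- All properties of the lift are checked after the injective `unit`, which turns it into id ⊗ f
    -- and both actions into multiplication in A.
    apply unit_injective hh
    rw [unit_lsmul, unit_liftLin hh f hf, unit_liftLin hh f hf, unit_lsmul,
      lTensor_rTensor_comm]
  map_rsmul b m := by
    apply unit_injective hh
    rw [unit_rsmul hN, unit_liftLin hh f hf, unit_liftLin hh f hf, unit_rsmul hM,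
      lTensor_rTensor_comm]
  colinear m := by
    have hinj : Function.Injective (N.unit.lTensor A) :=
      Module.Flat.lTensor_preserves_injective_linearMap _ (unit_injective hh)
    have h1 : ∀ (M : RelHopfModule π) (m : M), M.unit.lTensor A (M.coact m) =
        TensorProduct.assoc ℂ A A M.Fibre
          ((Coalgebra.comul (R := ℂ)).rTensor M.Fibre (M.unit m)) := by
      intro M m
      rw [unit, LinearMap.lTensor_comp, LinearMap.comp_apply, ← M.coassoc, LinearMap.comp_apply]
      generalize M.coact m = z
      induction z with
      | zero => simp
      | add s t hs ht => simp only [map_add, hs, ht]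
      | tmul p q =>
        simp only [LinearMap.rTensor_tmul, LinearMap.lTensor_tmul]
        generalize Coalgebra.comul (R := ℂ) p = z
        induction z with
        | zero => simp
        | add s t hs ht => simp only [map_add, TensorProduct.add_tmul, hs, ht]
        | tmul p q => simp
    apply hinj
    have h2 : N.unit ∘ₗ liftLin hh f = f.lTensor A ∘ₗ M.unit :=
      LinearMap.ext (unit_liftLin hh f hf)
    rw [h1, unit_liftLin hh f hf, ← LinearMap.comp_apply (N.unit.lTensor A),
      ← LinearMap.lTensor_comp, h2, LinearMap.lTensor_comp, LinearMap.comp_apply, h1]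
    generalize M.unit m = z
    induction z with
    | zero => simp
    | add s t hs ht => simp only [map_add, hs, ht]
    | tmul p q =>
      simp only [LinearMap.rTensor_tmul, LinearMap.lTensor_tmul]
      generalize Coalgebra.comul (R := ℂ) p = z
      induction z with
      | zero => simp
      | add s t hs ht => simp only [map_add, TensorProduct.add_tmul, hs, ht]
      | tmul p q => simp

theorem liftLin_comp {M N P : RelHopfModule π} (f : M.Fibre →ₗ[ℂ] N.Fibre)
    (hf : ∀ x, N.fibreCoact (f x) = f.lTensor H (M.fibreCoact x)) (g : N.Fibre →ₗ[ℂ] P.Fibre)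
    (hg : ∀ x, P.fibreCoact (g x) = g.lTensor H (N.fibreCoact x)) (m : M) :
    liftLin hh g (liftLin hh f m) = liftLin hh (g ∘ₗ f) m := by
  apply unit_injective hh
  rw [unit_liftLin hh g hg, unit_liftLin hh f hf, unit_liftLin, LinearMap.lTensor_comp,
    LinearMap.comp_apply]
  intro x
  rw [LinearMap.comp_apply, hg, hf, LinearMap.lTensor_comp, LinearMap.comp_apply]

theorem liftLin_id (m : M) : liftLin hh LinearMap.id m = m := by
  rw [liftLin, LinearMap.lTensor_id, LinearMap.id_comp, LinearMap.comp_apply, counit'_unit]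

end Lift
end RelHopfModule

namespace RelHopfModule

/-! ### Subobjects and simplicity of the fibre -/

section Simple

variable {A : Type u} {H : Type v} [Ring A] [HopfAlgebra ℂ A] [Ring H] [HopfAlgebra ℂ H]
  {π : A →ₐc[ℂ] H}

/-- A subspace of `M` stable under both actions and the coaction, as a relative Hopf module. -/
def subobject (M : RelHopfModule π) (W : Submodule ℂ M)
    (hl : ∀ (b : coinv π), ∀ m ∈ W, b • m ∈ W)
    (hr : ∀ (b : (coinv π)ᵐᵒᵖ), ∀ m ∈ W, b • m ∈ W)
    (hc : ∀ m ∈ W, M.coact m ∈ LinearMap.range (W.subtype.lTensor A)) : RelHopfModule π :=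
  letI : Module (coinv π) W :=
    { smul := fun b w => ⟨b • (w : M), hl b w w.2⟩
      one_smul := fun w => Subtype.ext (one_smul _ (w : M))
      mul_smul := fun b c w => Subtype.ext (mul_smul b c (w : M))
      smul_zero := fun b => Subtype.ext (smul_zero b)
      smul_add := fun b x y => Subtype.ext (smul_add b (x : M) y)
      add_smul := fun b c x => Subtype.ext (add_smul b c (x : M))
      zero_smul := fun x => Subtype.ext (zero_smul _ (x : M)) }
  letI : Module (coinv π)ᵐᵒᵖ W :=
    { smul := fun b w => ⟨b • (w : M), hr b w w.2⟩
      one_smul := fun w => Subtype.ext (one_smul _ (w : M))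
      mul_smul := fun b c w => Subtype.ext (mul_smul b c (w : M))
      smul_zero := fun b => Subtype.ext (smul_zero b)
      smul_add := fun b x y => Subtype.ext (smul_add b (x : M) y)
      add_smul := fun b c x => Subtype.ext (add_smul b c (x : M))
      zero_smul := fun x => Subtype.ext (zero_smul _ (x : M)) }
  haveI : IsScalarTower ℂ (coinv π) W := ⟨fun r b w => Subtype.ext (smul_assoc r b (w : M))⟩
  haveI : IsScalarTower ℂ (coinv π)ᵐᵒᵖ W := ⟨fun r b w => Subtype.ext (smul_assoc r b (w : M))⟩
  haveI : SMulCommClass (coinv π) (coinv π)ᵐᵒᵖ W :=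
    ⟨fun b c w => Subtype.ext (smul_comm b c (w : M))⟩
  have key : ∀ w : W, W.subtype.lTensor A (restrictCoact A M.coact W hc w) = M.coact w :=
    lTensor_restrictCoact A M.coact W hc
  { carrier := W
    coact := restrictCoact A M.coact W hc
    coassoc := fun w => by
      have hinj : Function.Injective ((W.subtype.lTensor A).lTensor A) :=
        Module.Flat.lTensor_preserves_injective_linearMap _ (lTensor_subtype_injective A W)
      have h1 : ∀ x : A ⊗[ℂ] W, (W.subtype.lTensor A).lTensor A
          (TensorProduct.assoc ℂ A A W ((Coalgebra.comul (R := ℂ)).rTensor W x)) =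
          TensorProduct.assoc ℂ A A M
            ((Coalgebra.comul (R := ℂ)).rTensor M (W.subtype.lTensor A x)) := by
        intro x
        induction x with
        | zero => simp
        | add x y hx hy => simp only [map_add, hx, hy]
        | tmul x y =>
          simp only [LinearMap.rTensor_tmul, LinearMap.lTensor_tmul]
          generalize Coalgebra.comul (R := ℂ) x = z
          induction z with
          | zero => simp
          | add x y hx hy => simp only [TensorProduct.add_tmul, map_add, hx, hy]
          | tmul p q => simp
      have h2 : ∀ x : A ⊗[ℂ] W, (W.subtype.lTensor A).lTensor A
          ((restrictCoact A M.coact W hc).lTensor A x) =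
          M.coact.lTensor A (W.subtype.lTensor A x) := by
        intro x
        induction x with
        | zero => simp
        | add x y hx hy => simp only [map_add, hx, hy]
        | tmul x y => simp [key]
      apply hinj
      rw [h1, h2, key, M.coassoc]
    counit_coact := fun w => by
      have h1 : ∀ x : A ⊗[ℂ] W,
          ((TensorProduct.lid ℂ W ((Coalgebra.counit (R := ℂ)).rTensor W x) : W) : M) =
          TensorProduct.lid ℂ M
            ((Coalgebra.counit (R := ℂ)).rTensor M (W.subtype.lTensor A x)) := by
        intro x
        induction x with
        | zero => simp
        | add x y hx hy => simp only [map_add, Submodule.coe_add, hx, hy]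
        | tmul x y => simp
      apply Subtype.ext
      rw [h1, key, M.counit_coact]
    coact_lsmul := fun b w => by
      have h1 : ∀ (x : A ⊗[ℂ] coinv π) (y : A ⊗[ℂ] W), W.subtype.lTensor A
          (TensorProduct.map₂ (LinearMap.mul ℂ A) (lactLin (coinv π) W) x y) =
          TensorProduct.map₂ (LinearMap.mul ℂ A) (lactLin (coinv π) M) x
            (W.subtype.lTensor A y) := by
        intro x y
        induction x with
        | zero => simp
        | add x x' hx hx' => simp only [map_add, LinearMap.add_apply, hx, hx']
        | tmul a c =>
          induction y with
          | zero => simp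
          | add y y' hy hy' => simp only [map_add, hy, hy']
          | tmul a' w => rfl
      apply lTensor_subtype_injective A W
      rw [h1, key, key, ← M.coact_lsmul]
      rfl
    coact_rsmul := fun w b => by
      have h1 : ∀ (x : A ⊗[ℂ] W) (y : A ⊗[ℂ] coinv π), W.subtype.lTensor A
          (TensorProduct.map₂ (LinearMap.mul ℂ A) (ractLin (coinv π) W) x y) =
          TensorProduct.map₂ (LinearMap.mul ℂ A) (ractLin (coinv π) M)
            (W.subtype.lTensor A x) y := by
        intro x y
        induction x with
        | zero => simp
        | add x x' hx hx' => simp only [map_add, LinearMap.add_apply, hx, hx']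
        | tmul a c =>
          induction y with
          | zero => simp
          | add y y' hy hy' => simp only [map_add, hy, hy']
          | tmul a' w => rfl
      apply lTensor_subtype_injective A W
      rw [h1, key, key, ← M.coact_rsmul]
      rfl }

variable {M N : RelHopfModule π}

theorem coact_mem_of_mem_range (P : Hom M M) (m : M) (hm : m ∈ LinearMap.range P.toLin) :
    M.coact m ∈ LinearMap.range ((LinearMap.range P.toLin).subtype.lTensor A) := by
  obtain ⟨m, rfl⟩ := hm
  refine ⟨P.toLin.rangeRestrict.lTensor A (M.coact m), ?_⟩
  rw [P.colinear, ← LinearMap.comp_apply, ← LinearMap.lTensor_comp]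
  rfl

/-- The image of an endomorphism of relative Hopf modules. -/
def image (P : Hom M M) : RelHopfModule π :=
  M.subobject (LinearMap.range P.toLin)
    (by rintro b _ ⟨m, rfl⟩; exact ⟨b • m, P.map_lsmul b m⟩)
    (by rintro b _ ⟨m, rfl⟩; exact ⟨b • m, P.map_rsmul b.unop m⟩)
    (coact_mem_of_mem_range P)

/-- The corestriction of an endomorphism to its image. -/
def toImage (P : Hom M M) : M →ₗ[ℂ] image P := P.toLin.rangeRestrict

/-- The inclusion of the image of an endomorphism. -/
def imageHom (P : Hom M M) : Hom (image P) M where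
  toLin := (LinearMap.range P.toLin).subtype
  map_lsmul _ _ := rfl
  map_rsmul _ _ := rfl
  colinear m := (lTensor_restrictCoact A M.coact _ (coact_mem_of_mem_range P) m).symm

theorem imageHom_injective (P : Hom M M) : Function.Injective (imageHom P).toLin :=
  Subtype.val_injective

theorem imageHom_toImage (P : Hom M M) (m : M) : (imageHom P).toLin (toImage P m) = P.toLin m := rfl

theorem toImage_surjective (P : Hom M M) : Function.Surjective (toImage P) :=
  P.toLin.surjective_rangeRestrict

theorem toImage_lsmul (P : Hom M M) (b : coinv π) (m : M) :
    toImage P (b • m) = b • toImage P m :=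
  Subtype.ext (P.map_lsmul b m)

theorem toImage_rsmul (P : Hom M M) (b : coinv π) (m : M) :
    toImage P (MulOpposite.op b • m) = MulOpposite.op b • toImage P m :=
  Subtype.ext (P.map_rsmul b m)

/-- The image is also a quotient of M, so finite generation and the equality of the two augmentation
subspaces pass to it. -/
theorem image_isModZero (hM : M.IsModZero) (P : Hom M M) : (image P).IsModZero := by
  refine ⟨?_, ?_⟩
  · have := hM.finite
    let f : M →ₗ[coinv π] image P :=
      { toFun := toImage P
        map_add' := map_add _
        map_smul' := toImage_lsmul P }
    exact Module.Finite.of_surjective f (toImage_surjective P)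
  · have hr : Submodule.span ℂ {x : image P | ∃ (b : coinv π) (m : image P),
        Coalgebra.counit (R := ℂ) (b : A) = 0 ∧ x = MulOpposite.op b • m} =
        (Submodule.span ℂ {x : M | ∃ (b : coinv π) (m : M),
          Coalgebra.counit (R := ℂ) (b : A) = 0 ∧ x = MulOpposite.op b • m}).map (toImage P) := by
      rw [Submodule.map_span]
      congr 1
      ext x
      constructor
      · rintro ⟨b, m, hb, rfl⟩
        obtain ⟨m, rfl⟩ := toImage_surjective P m
        exact ⟨_, ⟨b, m, hb, rfl⟩, toImage_rsmul P b m⟩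
      · rintro ⟨_, ⟨b, m, hb, rfl⟩, rfl⟩
        exact ⟨b, _, hb, toImage_rsmul P b m⟩
    have hl : Submodule.span ℂ {x : image P | ∃ (b : coinv π) (m : image P),
        Coalgebra.counit (R := ℂ) (b : A) = 0 ∧ x = b • m} =
        (Submodule.span ℂ {x : M | ∃ (b : coinv π) (m : M),
          Coalgebra.counit (R := ℂ) (b : A) = 0 ∧ x = b • m}).map (toImage P) := by
      rw [Submodule.map_span]
      congr 1
      ext x
      constructor
      · rintro ⟨b, m, hb, rfl⟩
        obtain ⟨m, rfl⟩ := toImage_surjective P m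
        exact ⟨_, ⟨b, m, hb, rfl⟩, toImage_lsmul P b m⟩
      · rintro ⟨_, ⟨b, m, hb, rfl⟩, rfl⟩
        exact ⟨b, _, hb, toImage_lsmul P b m⟩
    rw [hr, hl, hM.comm_aug]

/-- By functoriality p lifts to an idempotent endomorphism of M, and its image is a subobject.
Simplicity makes it 0 or onto, and an idempotent that is onto is the identity. -/
theorem eq_zero_or_eq_id_of_idempotent {h : Module.Dual ℂ H} (hh : IsHaar h)
    (hM : M.IsSimpleModZero) (p : M.Fibre →ₗ[ℂ] M.Fibre)
    (hp : ∀ x, M.fibreCoact (p x) = p.lTensor H (M.fibreCoact x)) (hpp : p ∘ₗ p = p) :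
    p = 0 ∨ p = LinearMap.id := by
  let P : Hom M M := liftHom hh hM.isModZero hM.isModZero p hp
  have hP : ∀ m, P.toLin (P.toLin m) = P.toLin m := fun m =>
    (liftLin_comp hh p hp p hp m).trans (by rw [hpp]; rfl)
  have hPf : ∀ m, M.toFibre (P.toLin m) = p (M.toFibre m) := toFibre_liftLin hh p hp
  rcases hM.eq_zero_or_surjective (image P) (image_isModZero hM.isModZero P) (imageHom P)
    (imageHom_injective P) with h0 | hs
  · left
    ext m
    have := h0 (toImage P m)
    rw [imageHom_toImage] at this
    change p (M.toFibre m) = 0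
    rw [← hPf, this, map_zero]
  · right
    ext m
    obtain ⟨n, rfl⟩ := hs m
    obtain ⟨n, rfl⟩ := toImage_surjective P n
    change p (M.toFibre _) = M.toFibre _
    rw [imageHom_toImage, ← hPf, hP]

/-- M embeds in A ⊗ M / B⁺M. -/
theorem fibre_nontrivial {h : Module.Dual ℂ H} (hh : IsHaar h)
    (hM : M.IsSimpleModZero) : Nontrivial M.Fibre := by
  by_contra hn
  rw [not_nontrivial_iff_subsingleton] at hn
  have := hM.nontrivial
  obtain ⟨m, hm⟩ := exists_ne (0 : M)
  refine hm (unit_injective hh ?_)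
  generalize M.unit m = t
  rw [map_zero]
  induction t with
  | zero => rfl
  | add s t hs ht => rw [hs, ht, add_zero]
  | tmul a x => rw [Subsingleton.elim x 0, TensorProduct.tmul_zero]

/-- The fibre of a simple object is a simple comodule. -/
theorem isSimpleModule_fibre [StarRing H] [StarModule ℂ H] (hH : IsCompactQuantumGroupAlgebra H)
    {h : Module.Dual ℂ H} (hh : IsHaar h) (hM : M.IsSimpleModZero) :
    IsSimpleModule (FreeAlgebra ℂ (Module.Dual ℂ H)) (OpMod (coactOp M.fibreCoact)) := by
  have hss := isSemisimpleModule_coactOp hH M.fibreCoact fibreCoact_coassoc fibreCoact_counit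
  have hn : Nontrivial (OpMod (coactOp M.fibreCoact)) := fibre_nontrivial hh hM
  have hs : IsSimpleOrder (Submodule (FreeAlgebra ℂ (Module.Dual ℂ H))
      (OpMod (coactOp M.fibreCoact))) := by
    refine ⟨fun W => ?_⟩
    -- By semisimplicity W is the image of a colinear idempotent, which must be 0 or the identity.
    obtain ⟨r, hr⟩ := IsSemisimpleModule.extension_property W.subtype W.subtype_injective
      LinearMap.id
    have hrW : ∀ x (hx : x ∈ W), r x = ⟨x, hx⟩ := fun x hx => LinearMap.congr_fun hr ⟨x, hx⟩
    let p := W.subtype ∘ₗ r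
    have hp := (coactOp_comm_iff (OpMod.toLin p)).1 (OpMod.toLin_comm p)
    have hpp : OpMod.toLin p ∘ₗ OpMod.toLin p = OpMod.toLin p := by
      refine LinearMap.ext fun x => ?_
      apply (OpMod.of (coactOp M.fibreCoact)).injective
      rw [LinearMap.comp_apply, OpMod.of_toLin, OpMod.of_toLin]
      exact congrArg Subtype.val (hrW _ (r _).2)
    rcases eq_zero_or_eq_id_of_idempotent hh hM (OpMod.toLin p) hp hpp with h0 | h1
    · left
      rw [eq_bot_iff]
      intro x hx
      have h2 : p x = 0 := LinearMap.congr_fun h0 x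
      have h3 : p x = x := congrArg Subtype.val (hrW x hx)
      rw [Submodule.mem_bot, ← h3, h2]
    · right
      rw [eq_top_iff]
      intro x _
      have h2 : p x = x := LinearMap.congr_fun h1 x
      rw [← h2]
      exact (r x).2
  exact { toIsSimpleOrder := hs }

/-- The inverse of a colinear bijection is colinear, and lifting respects composition and
identities. -/
theorem isomorphic_of_bijective {h : Module.Dual ℂ H} (hh : IsHaar h)
    (hM : M.IsModZero) (hN : N.IsModZero) (f : M.Fibre →ₗ[ℂ] N.Fibre)
    (hf : ∀ x, N.fibreCoact (f x) = f.lTensor H (M.fibreCoact x)) (hb : Function.Bijective f) :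
    Isomorphic M N := by
  let e := LinearEquiv.ofBijective f hb
  have hg : ∀ y, M.fibreCoact (e.symm y) = e.symm.toLinearMap.lTensor H (N.fibreCoact y) := by
    intro y
    obtain ⟨x, rfl⟩ := e.surjective y
    have : N.fibreCoact (e x) = e.toLinearMap.lTensor H (M.fibreCoact x) := hf x
    rw [this, e.symm_apply_apply, ← LinearMap.comp_apply, ← LinearMap.lTensor_comp]
    simp
  refine ⟨liftHom hh hM hN f hf, liftHom hh hN hM e.symm.toLinearMap hg, fun m => ?_, fun n => ?_⟩
  · refine (liftLin_comp hh f hf e.symm.toLinearMap hg m).trans ?_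
    have : e.symm.toLinearMap ∘ₗ f = LinearMap.id := LinearMap.ext e.symm_apply_apply
    rw [this, liftLin_id]
  · refine (liftLin_comp hh e.symm.toLinearMap hg f hf n).trans ?_
    have : f ∘ₗ e.symm.toLinearMap = LinearMap.id := LinearMap.ext e.apply_symm_apply
    rw [this, liftLin_id]

end Simple

end RelHopfModule

/-! ### The involution, the counit and the coinvariants. -/

section Star

variable {A : Type u} {H : Type v} [Ring A] [HopfAlgebra ℂ A] [StarRing A] [StarModule ℂ A]
  [Ring H] [HopfAlgebra ℂ H] [StarRing H] [StarModule ℂ H]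

/-- Since Δ is a *-map, a ↦ conj ε(a^*) is a left counit, and a left counit agrees with the right
counit ε. -/
theorem counit_star [HopfStarAlgebra A] (a : A) :
    Coalgebra.counit (R := ℂ) (star a) = star (Coalgebra.counit (R := ℂ) a) := by
  let ε' : A →ₗ[ℂ] ℂ :=
    { toFun := fun a => star (Coalgebra.counit (R := ℂ) (star a))
      map_add' := fun x y => by simp
      map_smul' := fun c x => by simp }
  have h1 : ∀ a : A, slice A ε' (Coalgebra.comul a) = a := by
    intro a
    have h := HopfStarAlgebra.comul_star (star a)
    rw [star_star] at h
    have h2 : TensorProduct.lid ℂ A (Coalgebra.counit.rTensor A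
        (Coalgebra.comul (R := ℂ) (star a))) = star a := by
      rw [Coalgebra.rTensor_counit_comul]; simp
    apply star_injective
    refine Eq.trans ?_ h2
    rw [h]
    generalize Coalgebra.comul (R := ℂ) (star a) = z
    induction z with
    | zero => simp
    | add s t hs ht => simp only [map_add, star_add, hs, ht]
    | tmul p q => simp [ε', TensorProduct.star_tmul]
  have h2 : ∀ a : A, ε' a = Coalgebra.counit a := by
    intro a
    have h3 : ∀ z : A ⊗[ℂ] A, Coalgebra.counit (R := ℂ) (slice A ε' z) =
        ε' (TensorProduct.rid ℂ A (Coalgebra.counit.lTensor A z)) := by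
      intro z
      induction z with
      | zero => simp
      | add s t hs ht => simp only [map_add, hs, ht]
      | tmul p q => simp [mul_comm]
    have h4 := h3 (Coalgebra.comul a)
    rw [h1, Coalgebra.lTensor_counit_comul] at h4
    simpa using h4.symm
  have := h2 (star a)
  rw [← this]
  simp [ε']

theorem star_mem_coinv [HopfStarAlgebra A] (π : A →ₐc[ℂ] H) (hπ : ∀ a, π (star a) = star (π a))
    {b : A} (hb : b ∈ coinv π) : star b ∈ coinv π := by
  rw [mem_coinv] at hb ⊢
  have h1 : ∀ z : A ⊗[ℂ] A, (π : A →ₗ[ℂ] H).lTensor A (star z) =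
      star ((π : A →ₗ[ℂ] H).lTensor A z) := by
    intro z
    induction z with
    | zero => simp
    | add s t hs ht => simp only [map_add, star_add, hs, ht]
    | tmul p q => simp [TensorProduct.star_tmul, hπ]
  rw [HopfStarAlgebra.comul_star, h1, hb, TensorProduct.star_tmul, star_one]

end Star

/-! ### Simple comodules as quotients of unitary corepresentations. -/

section Cover

variable {H : Type v} [Ring H] [HopfAlgebra ℂ H] [StarRing H] [StarModule ℂ H]

/-- A simple comodule over a compact quantum group algebra is a quotient of a finite-dimensional
unitary corepresentation. -/
theorem exists_unitary_cover (hH : IsCompactQuantumGroupAlgebra H) {X : Type*}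
    [AddCommGroup X] [Module ℂ X] (δ : X →ₗ[ℂ] H ⊗[ℂ] X)
    (coassoc : ∀ x, TensorProduct.assoc ℂ H H X
      ((Coalgebra.comul (R := ℂ)).rTensor X (δ x)) = δ.lTensor H (δ x))
    (counit : ∀ x, slice X Coalgebra.counit (δ x) = x)
    (hs : IsSimpleModule (FreeAlgebra ℂ (Module.Dual ℂ H)) (OpMod (coactOp δ))) :
    ∃ (n : ℕ) (w : Matrix (Fin n) (Fin n) H) (v : Fin n → X), IsUnitaryCorep w ∧
      Submodule.span ℂ (Set.range v) = ⊤ ∧ ∀ i, δ (v i) = ∑ k, w i k ⊗ₜ[ℂ] v k := by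
  have := isSemisimpleModule_of_cqg hH
  have hnt : Nontrivial X := IsSimpleModule.nontrivial (FreeAlgebra ℂ (Module.Dual ℂ H))
    (OpMod (coactOp δ))
  obtain ⟨x₀, hx₀⟩ := exists_ne (0 : X)
  obtain ⟨ξ, hξ⟩ : ∃ ξ : Module.Dual ℂ X, ξ x₀ ≠ 0 := by
    by_contra! h
    exact hx₀ ((Module.forall_dual_apply_eq_zero_iff ℂ x₀).1 h)
  -- The coefficient map x ↦ x₍₋₁₎ ξ(x₍₀₎) is colinear, and nonzero because ε ∘ c = ξ. By simplicity
  -- it embeds X in H, and semisimplicity of H supplies a colinear retraction.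
  let c : X →ₗ[ℂ] H := (TensorProduct.rid ℂ H).toLinearMap ∘ₗ ξ.lTensor H ∘ₗ δ
  have hc : ∀ x, Coalgebra.comul (R := ℂ) (c x) = c.lTensor H (δ x) := by
    intro x
    have h1 : ∀ t : H ⊗[ℂ] X, Coalgebra.comul (R := ℂ)
        (TensorProduct.rid ℂ H (ξ.lTensor H t)) =
        ((TensorProduct.rid ℂ H).toLinearMap ∘ₗ ξ.lTensor H).lTensor H
          (TensorProduct.assoc ℂ H H X ((Coalgebra.comul (R := ℂ)).rTensor X t)) := by
      intro t
      induction t with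
      | zero => simp
      | add s t hs ht => simp only [map_add, hs, ht]
      | tmul a x =>
        simp only [LinearMap.lTensor_tmul, TensorProduct.rid_tmul, map_smul,
          LinearMap.rTensor_tmul]
        generalize Coalgebra.comul (R := ℂ) a = z
        induction z with
        | zero => simp
        | add s t hs ht => simp only [map_add, TensorProduct.add_tmul, smul_add, hs, ht]
        | tmul p q => simp
    change Coalgebra.comul (R := ℂ) (TensorProduct.rid ℂ H (ξ.lTensor H (δ x))) = _
    rw [h1, coassoc, ← LinearMap.comp_apply, ← LinearMap.lTensor_comp]
    rfl
  have hεc : ∀ x, Coalgebra.counit (R := ℂ) (c x) = ξ x := by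
    intro x
    conv_rhs => rw [← counit x]
    simp only [c, LinearMap.comp_apply]
    generalize δ x = t
    induction t with
    | zero => simp
    | add s t hs ht => simp only [map_add, hs, ht]
    | tmul a x => simp [mul_comm]
  let C : OpMod (coactOp δ) →ₗ[FreeAlgebra ℂ (Module.Dual ℂ H)]
      OpMod (coactOp (Coalgebra.comul (R := ℂ) (A := H))) :=
    OpMod.homOf c ((coactOp_comm_iff c).2 hc)
  have hC : C ≠ 0 := by
    intro h0
    apply hξ
    have : c x₀ = 0 := LinearMap.congr_fun h0 x₀
    rw [← hεc, this, map_zero]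
  obtain ⟨r, hr⟩ := IsSemisimpleModule.extension_property C (LinearMap.injective_of_ne_zero hC)
    LinearMap.id
  have hrc : ∀ x, OpMod.toLin r (c x) = x := fun x => LinearMap.congr_fun hr x
  -- Coefficients span H, so the retraction is nonzero on some column of a unitary corepresentation;
  -- by simplicity that column maps onto X.
  obtain ⟨n, w, hw, j, hj⟩ : ∃ (n : ℕ) (w : Matrix (Fin n) (Fin n) H) (_ : IsUnitaryCorep w)
      (j : Fin n), OpMod.toLin r ∘ₗ corepCol w j ≠ 0 := by
    by_contra! h
    have h0 : OpMod.toLin r = 0 := by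
      refine LinearMap.ext_on hH.2 ?_
      rintro _ ⟨n, w, hw, i, j, rfl⟩
      rw [← corepCol_single w i j, ← LinearMap.comp_apply, h n w hw j]
      rfl
    apply hx₀
    rw [← hrc x₀, h0, LinearMap.zero_apply]
  let q : OpMod (corepOp w) →ₗ[FreeAlgebra ℂ (Module.Dual ℂ H)] OpMod (coactOp δ) :=
    r ∘ₗ OpMod.homOf (corepCol w j) (hw.corepCol_comm j)
  have hq : q ≠ 0 := fun h0 => hj (LinearMap.ext fun x => LinearMap.congr_fun h0 x)
  refine ⟨n, w, fun i => OpMod.toLin r (w i j), hw, ?_, fun i => ?_⟩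
  · rw [eq_top_iff]
    intro y _
    obtain ⟨x, hx⟩ := LinearMap.surjective_of_ne_zero hq (OpMod.of (coactOp δ) y)
    have hx' : OpMod.toLin r (corepCol w j ((OpMod.of (corepOp w)).symm x)) = y := hx
    rw [← hx', corepCol_apply, map_sum]
    refine Submodule.sum_mem _ fun i _ => ?_
    rw [map_smul]
    exact Submodule.smul_mem _ _ (Submodule.subset_span ⟨i, rfl⟩)
  · rw [(coactOp_comm_iff (OpMod.toLin r)).1 (OpMod.toLin_comm r), hw.comul_coeff, map_sum]
    simp

end Cover

namespace RelHopfModule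

/-! ### Invariant pairings, their forms on the fibre, and conjugation. -/

section Pairing

variable {A : Type u} {H : Type v} [Ring A] [HopfAlgebra ℂ A] [Ring H] [HopfAlgebra ℂ H]
  {π : A →ₐc[ℂ] H} {M N : RelHopfModule π}

/-- For an invariant bilinear form `β` and an injective antilinear map `c` compatible with the
coactions, the map `x ↦ ∑ β(v_k, x) c(v_k)` given by a unitary spanning family `v` is colinear, and
zero only if `β` is. -/
theorem exists_colinear_of_form [StarRing H] [StarModule ℂ H] {n : ℕ}
    {w : Matrix (Fin n) (Fin n) H} (hw : IsUnitaryCorep w)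
    {X Y : Type*} [AddCommGroup X] [Module ℂ X] [AddCommGroup Y] [Module ℂ Y]
    {δ : X →ₗ[ℂ] H ⊗[ℂ] X} {δ' : Y →ₗ[ℂ] H ⊗[ℂ] Y} (v : Fin n → X)
    (hv : Submodule.span ℂ (Set.range v) = ⊤) (hδ : ∀ i, δ (v i) = ∑ k, w i k ⊗ₜ[ℂ] v k)
    (β : X →ₗ[ℂ] X →ₗ[ℂ] ℂ)
    (hβ : ∀ x y, TensorProduct.map₂ (LinearMap.mul ℂ H) β (δ x) (δ y) = 1 ⊗ₜ[ℂ] β x y)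
    (c : X →ₛₗ[starRingEnd ℂ] Y) (hc : Function.Injective c)
    (hcδ : ∀ x, δ' (c x) =
      TensorProduct.map (starLinearEquiv ℂ (A := H)).toLinearMap c (δ x)) :
    ∃ T : X →ₗ[ℂ] Y, (∀ x, δ' (T x) = T.lTensor H (δ x)) ∧ (T = 0 → β = 0) := by
  let T : X →ₗ[ℂ] Y := ∑ k, (β (v k)).smulRight (c (v k))
  have hT : ∀ x, T x = ∑ k, β (v k) x • c (v k) := fun x => by simp [T]
  refine ⟨T, ?_, fun h0 => ?_⟩
  -- Invariance of β on the v_i, written as w · X = (β(v_i, v_j)). Multiplying by w^* expresses X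
  -- through the entries of w^*, which is the colinearity of T on v_j.
  · have hmat : w * Matrix.of (fun k j => ∑ l, β (v k) (v l) • w j l) =
        Matrix.of fun i j => algebraMap ℂ H (β (v i) (v j)) := by
      ext i j
      have := congrArg (TensorProduct.rid ℂ H) (hβ (v i) (v j))
      rw [hδ, hδ] at this
      simp only [map_sum, LinearMap.sum_apply, TensorProduct.map₂_apply_tmul,
        TensorProduct.map_tmul, LinearMap.mul_apply', TensorProduct.rid_tmul] at this
      rw [Matrix.of_apply, Algebra.algebraMap_eq_smul_one, ← this]
      simp only [Matrix.mul_apply, Matrix.of_apply, Finset.mul_sum, mul_smul_comm]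
      exact Finset.sum_comm
    have hmat2 := congrArg (star w * ·) hmat
    simp only [← mul_assoc, Unitary.star_mul_self_of_mem hw.unitary, one_mul] at hmat2
    have key : δ' ∘ₗ T = T.lTensor H ∘ₗ δ := by
      refine LinearMap.ext_on hv ?_
      rintro _ ⟨j, rfl⟩
      have h3 : ∀ i, ∑ l, β (v i) (v l) • w j l = ∑ k, β (v k) (v j) • star (w k i) := by
        intro i
        have := congrFun (congrFun hmat2 i) j
        simpa [Matrix.mul_apply, Matrix.star_apply, Algebra.algebraMap_eq_smul_one] using this
      rw [LinearMap.comp_apply, LinearMap.comp_apply, hT, hδ]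
      simp only [map_sum, map_smul, hcδ, hδ, TensorProduct.map_tmul, LinearMap.lTensor_tmul, hT,
        TensorProduct.tmul_sum, Finset.smul_sum]
      rw [Finset.sum_comm]
      conv_rhs => rw [Finset.sum_comm]
      refine Finset.sum_congr rfl fun i _ => ?_
      simp only [TensorProduct.tmul_smul, TensorProduct.smul_tmul', ← TensorProduct.sum_tmul, h3]
      rfl
    exact LinearMap.congr_fun key
  · have h1 : ∀ y k, β (v k) y = 0 := by
      intro y
      -- Injectivity of c makes the argument vanish; pairing it with y gives ∑ |β(v_k, y)|² = 0.
      -- Positivity stands in for linear independence of the v_k, which is not assumed.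
      have h2 : c (∑ k, star (β (v k) y) • v k) = 0 := by
        have := LinearMap.congr_fun h0 y
        rw [hT] at this
        simpa using this
      have h3 := congrArg (fun x => β x y) (hc (h2.trans (map_zero c).symm))
      simp only [map_sum, LinearMap.sum_apply, map_smul, LinearMap.smul_apply, smul_eq_mul,
        map_zero, LinearMap.zero_apply] at h3
      have h4 : ∑ k, ‖β (v k) y‖ ^ 2 = 0 := by
        have : ((∑ k, ‖β (v k) y‖ ^ 2 : ℝ) : ℂ) = 0 := by
          rw [← h3]
          push_cast
          refine Finset.sum_congr rfl fun k _ => ?_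
          exact (Complex.conj_mul' _).symm
        exact_mod_cast this
      intro k
      have := (Finset.sum_eq_zero_iff_of_nonneg fun k _ => by positivity).1 h4 k (Finset.mem_univ k)
      simpa using this
    refine LinearMap.ext_on hv ?_
    rintro _ ⟨k, rfl⟩
    exact LinearMap.ext fun y => h1 y k

/-- The form `(x, y) ↦ ε(P(x, y))` on the fibre. -/
def fibreForm (hM : M.IsModZero) (P : M →ₗ[ℂ] M →ₗ[ℂ] coinv π)
    (hl : ∀ (b : coinv π) (m n : M), P (b • m) n = b * P m n)
    (hr : ∀ (b : coinv π) (m n : M), P m (MulOpposite.op b • n) = P m n * b) :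
    M.Fibre →ₗ[ℂ] M.Fibre →ₗ[ℂ] ℂ :=
  M.aug.liftQ (LinearMap.flip (M.aug.liftQ (P.compr₂ ((Coalgebra.counit (R := ℂ)) ∘ₗ
      (Subalgebra.toSubmodule (coinv π)).subtype)).flip (by
    -- P is right linear in its second variable, so there B⁺M has to be read as MB⁺.
    rw [aug, ← hM.comm_aug]
    refine Submodule.span_le.2 ?_
    rintro _ ⟨b, m, hb, rfl⟩
    ext n
    change Coalgebra.counit (R := ℂ) ((P n (MulOpposite.op b • m) : coinv π) : A) = 0
    rw [hr, Subalgebra.coe_mul, Bialgebra.counit_mul, hb, mul_zero]))) (by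
  refine Submodule.span_le.2 ?_
  rintro _ ⟨b, m, hb, rfl⟩
  ext n
  change Coalgebra.counit (R := ℂ) ((P (b • m) n : coinv π) : A) = 0
  rw [hl, Subalgebra.coe_mul, Bialgebra.counit_mul, hb, zero_mul])

section

variable (hM : M.IsModZero) (P : M →ₗ[ℂ] M →ₗ[ℂ] coinv π)
  (hl : ∀ (b : coinv π) (m n : M), P (b • m) n = b * P m n)
  (hr : ∀ (b : coinv π) (m n : M), P m (MulOpposite.op b • n) = P m n * b)

theorem fibreForm_toFibre (m n : M) : fibreForm hM P hl hr (M.toFibre m) (M.toFibre n) =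
    Coalgebra.counit (R := ℂ) (P m n : A) := rfl

/-- Applying π ⊗ ε to the colinearity of P turns its coinvariant side into π(P(m, n)) ⊗ 1, and π is
ε · 1 on B. -/
theorem fibreForm_invariant
    (hP : ∀ m n, coinvCoact π (P m n) =
      TensorProduct.map₂ (LinearMap.mul ℂ A) P (M.coact m) (M.coact n))
    (x y : M.Fibre) :
    TensorProduct.map₂ (LinearMap.mul ℂ H) (fibreForm hM P hl hr) (M.fibreCoact x)
      (M.fibreCoact y) = 1 ⊗ₜ[ℂ] fibreForm hM P hl hr x y := by
  obtain ⟨m, rfl⟩ := M.toFibre_surjective x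
  obtain ⟨n, rfl⟩ := M.toFibre_surjective y
  have h1 : ∀ s t : A ⊗[ℂ] M, TensorProduct.map₂ (LinearMap.mul ℂ H) (fibreForm hM P hl hr)
      ((π : A →ₗ[ℂ] H).rTensor M.Fibre (M.toFibre.lTensor A s))
      ((π : A →ₗ[ℂ] H).rTensor M.Fibre (M.toFibre.lTensor A t)) =
      (π : A →ₗ[ℂ] H).rTensor ℂ ((Coalgebra.counit (R := ℂ)).lTensor A
        ((Subalgebra.toSubmodule (coinv π)).subtype.lTensor A
          (TensorProduct.map₂ (LinearMap.mul ℂ A) P s t))) := by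
    intro s t
    induction s with
    | zero => simp
    | add s s' hs hs' => simp only [map_add, LinearMap.add_apply, hs, hs']
    | tmul a m =>
      induction t with
      | zero => simp
      | add t t' ht ht' => simp only [map_add, ht, ht']
      | tmul a' m' => simp [fibreForm_toFibre]
  rw [fibreCoact_toFibre, fibreCoact_toFibre, unit, LinearMap.comp_apply, LinearMap.comp_apply,
    h1, ← hP, lTensor_coinvCoact, Coalgebra.lTensor_counit_comul, LinearMap.rTensor_tmul,
    LinearMap.coe_coe, hom_coinv, fibreForm_toFibre, Algebra.algebraMap_eq_smul_one,
    TensorProduct.smul_tmul, smul_eq_mul, mul_one]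

/-- With b = P(m, n), b = b₍₁₎ ε(b₍₂₎) = m₍₋₁₎ n₍₋₁₎ ε(P(m₍₀₎, n₍₀₎)) by colinearity. -/
theorem eq_zero_of_fibreForm_eq_zero
    (hP : ∀ m n, coinvCoact π (P m n) =
      TensorProduct.map₂ (LinearMap.mul ℂ A) P (M.coact m) (M.coact n))
    (h0 : fibreForm hM P hl hr = 0) (m n : M) : P m n = 0 := by
  have h1 : ∀ s t : A ⊗[ℂ] M, (Coalgebra.counit (R := ℂ)).lTensor A
        ((Subalgebra.toSubmodule (coinv π)).subtype.lTensor A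
          (TensorProduct.map₂ (LinearMap.mul ℂ A) P s t)) = 0 := by
    intro s t
    induction s with
    | zero => simp
    | add s s' hs hs' => simp only [map_add, LinearMap.add_apply, hs, hs', add_zero]
    | tmul a m =>
      induction t with
      | zero => simp
      | add t t' ht ht' => simp only [map_add, ht, ht', add_zero]
      | tmul a' m' =>
        have h2 := fibreForm_toFibre hM P hl hr m m'
        rw [h0] at h2
        have h3 : Coalgebra.counit (R := ℂ) (P m m' : A) = 0 := h2.symm
        simp [h3]
  have h2 := h1 (M.coact m) (M.coact n)
  rw [← hP, lTensor_coinvCoact, Coalgebra.lTensor_counit_comul] at h2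
  apply Subtype.ext
  have := congrArg (TensorProduct.rid ℂ A) h2
  simpa using this

end

/-- An invariant pairing on a simple object vanishes if its conjugate is not isomorphic to it. -/
theorem pairing_eq_zero [StarRing A] [StarModule ℂ A] [HopfStarAlgebra A]
    [StarRing H] [StarModule ℂ H] (hH : IsCompactQuantumGroupAlgebra H)
    (hπ : ∀ a, π (star a) = star (π a)) (hM : M.IsSimpleModZero) (hN : N.IsSimpleModZero)
    (hMN : ¬ Isomorphic M N) (P : M →ₗ[ℂ] M →ₗ[ℂ] coinv π)
    (hl : ∀ (b : coinv π) (m n : M), P (b • m) n = b * P m n)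
    (hr : ∀ (b : coinv π) (m n : M), P m (MulOpposite.op b • n) = P m n * b)
    (hP : ∀ m n, coinvCoact π (P m n) =
      TensorProduct.map₂ (LinearMap.mul ℂ A) P (M.coact m) (M.coact n))
    (c : M →ₛₗ[starRingEnd ℂ] N) (c' : N →ₛₗ[starRingEnd ℂ] M) (hc'c : ∀ m, c' (c m) = m)
    (hc : ∀ b b' : coinv π, (b' : A) = star (b : A) → ∀ m,
      c (b • m) = MulOpposite.op b' • c m)
    (hc' : ∀ b b' : coinv π, (b' : A) = star (b : A) → ∀ m,
      c' (b • m) = MulOpposite.op b' • c' m)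
    (hcδ : ∀ m, N.coact (c m) =
      TensorProduct.map (starLinearEquiv ℂ (A := A)).toLinearMap c (M.coact m)) (m n : M) :
    P m n = 0 := by
  obtain ⟨h, h1, h2⟩ := exists_haar hH
  have hh : IsHaar h := ⟨h1, h2⟩
  -- Conjugation exchanges left and right actions and preserves B⁺, so it sends B⁺M into NB⁺ = B⁺N.
  -- Both c and its inverse c' need this: the first to descend to fibres, the second for injectivity
  -- there.
  have haug : ∀ {M N : RelHopfModule π}, N.IsModZero → ∀ c : M →ₛₗ[starRingEnd ℂ] N,
      (∀ b b' : coinv π, (b' : A) = star (b : A) → ∀ m, c (b • m) = MulOpposite.op b' • c m) →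
      M.aug ≤ N.aug.comap c := by
    intro M N hN c hc
    refine Submodule.span_le.2 ?_
    rintro _ ⟨b, m, hb, rfl⟩
    change c (b • m) ∈ N.aug
    rw [← toFibre_eq_zero, hc b ⟨star (b : A), star_mem_coinv π hπ b.2⟩ rfl, toFibre_rsmul hN,
      counit_star, hb, star_zero, zero_smul]
  let cbar : M.Fibre →ₛₗ[starRingEnd ℂ] N.Fibre := M.aug.liftQ (N.toFibre.comp c) (by
    refine (haug hN.isModZero c hc).trans fun x hx => ?_
    exact toFibre_eq_zero.2 hx)
  have hcbar : ∀ m, cbar (M.toFibre m) = N.toFibre (c m) := fun m => rfl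
  have hinj : Function.Injective cbar := by
    rw [injective_iff_map_eq_zero]
    intro x hx
    obtain ⟨m, rfl⟩ := M.toFibre_surjective x
    rw [hcbar, toFibre_eq_zero] at hx
    rw [toFibre_eq_zero, ← hc'c m]
    exact haug hM.isModZero c' hc' hx
  have hcδ' : ∀ x, N.fibreCoact (cbar x) =
      TensorProduct.map (starLinearEquiv ℂ (A := H)).toLinearMap cbar (M.fibreCoact x) := by
    intro x
    obtain ⟨m, rfl⟩ := M.toFibre_surjective x
    rw [hcbar, fibreCoact_toFibre, fibreCoact_toFibre, unit, unit, LinearMap.comp_apply,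
      LinearMap.comp_apply, hcδ]
    generalize M.coact m = t
    induction t with
    | zero => simp
    | add s t hs ht => simp only [map_add, hs, ht]
    | tmul a m => simp [hcbar, hπ]
  have hsM := isSimpleModule_fibre hH hh hM
  have hsN := isSimpleModule_fibre hH hh hN
  obtain ⟨k, w, v, hw, hv, hδ⟩ := exists_unitary_cover hH M.fibreCoact fibreCoact_coassoc
    fibreCoact_counit hsM
  obtain ⟨T, hT, hT0⟩ := exists_colinear_of_form hw v hv hδ (fibreForm hM.isModZero P hl hr)
    (fibreForm_invariant hM.isModZero P hl hr hP) cbar hinj hcδ'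
  refine eq_zero_of_fibreForm_eq_zero hM.isModZero P hl hr hP (hT0 ?_) m n
  by_contra hne
  -- Schur: a nonzero colinear map between the two simple fibres is bijective, so it lifts to the
  -- excluded isomorphism.
  let T' := OpMod.homOf (ρ := coactOp M.fibreCoact) (σ := coactOp N.fibreCoact) T
    ((coactOp_comm_iff T).2 hT)
  have hT' : T' ≠ 0 := fun h0 => hne (LinearMap.ext fun x => LinearMap.congr_fun h0 x)
  exact hMN (isomorphic_of_bijective hh hM.isModZero hN.isModZero T hT
    (LinearMap.bijective_of_ne_zero (f := T') hT'))

end Pairing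

end RelHopfModule

namespace RelHopfModule

/-! ### Contractions with a metric and nondegeneracy. -/

section Contract

variable {A : Type u} {H : Type v} [Ring A] [HopfAlgebra ℂ A] [Ring H] [HopfAlgebra ℂ H]
  {π : A →ₐc[ℂ] H} {M N : RelHopfModule π}

theorem tensor_induction {p : Tensor M N → Prop} (t : Tensor M N) (zero : p 0)
    (add : ∀ s t, p s → p t → p (s + t)) (tmul : ∀ m n, p (tmul m n)) : p t := by
  obtain ⟨z, rfl⟩ := (balancedRel (coinv π) M N).mkQ_surjective t
  induction z with
  | zero => exact zero
  | add s t hs ht => rw [map_add]; exact add _ _ hs ht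
  | tmul m n => exact tmul m n

theorem Pairing.contractLeft_tmul (P : Pairing M) (ω m n : M) :
    P.contractLeft ω (tmul m n) = P.val ω m • n :=
  BalTensor.lift_btmul _ _ _ m n

theorem Pairing.contractRight_tmul (P : Pairing M) (ω m n : M) :
    P.contractRight ω (tmul m n) = MulOpposite.op (P.val n ω) • m :=
  BalTensor.lift_btmul _ _ _ m n

/-- `ω ↦ ((ω, ·) ⊗_B id) t` as a linear map. -/
def Pairing.contract (P : Pairing M) (t : Tensor M M) : M →ₗ[ℂ] M where
  toFun ω := P.contractLeft ω t
  map_add' ω η := by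
    induction t using tensor_induction with
    | zero => simp
    | add s t hs ht => rw [map_add, hs, ht, map_add, map_add]; abel
    | tmul m n => simp only [contractLeft_tmul, map_add, LinearMap.add_apply, add_smul]
  map_smul' r ω := by
    induction t using tensor_induction with
    | zero => simp
    | add s t hs ht => rw [map_add, hs, ht, map_add, smul_add]
    | tmul m n =>
      simp only [contractLeft_tmul, map_smul, LinearMap.smul_apply, smul_assoc, RingHom.id_apply]

theorem Pairing.contract_apply (P : Pairing M) (t : Tensor M M) (ω : M) :
    P.contract t ω = P.contractLeft ω t := rfl

theorem Pairing.contract_lsmul (P : Pairing M) (t : Tensor M M) (b : coinv π) (ω : M) :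
    P.contract t (b • ω) = b • P.contract t ω := by
  rw [contract_apply, contract_apply]
  induction t using tensor_induction with
  | zero => simp
  | add s t hs ht => rw [map_add, hs, ht, map_add, smul_add]
  | tmul m n => rw [contractLeft_tmul, contractLeft_tmul, val_lsmul, mul_smul]

/-- `(id ⊗_B ((·, ·) ⊗_B id)) (s ⊗_B t)`. -/
def Pairing.insert (P : Pairing M) (t : Tensor M M) : Tensor M M →ₗ[ℂ] Tensor M M :=
  BalTensor.lift (coinv π) ((btmul (coinv π)).compl₂ (P.contract t)) (by
    intro m b n
    rw [LinearMap.compl₂_apply, LinearMap.compl₂_apply, contract_lsmul, btmul_smul])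

theorem Pairing.insert_tmul (P : Pairing M) (t : Tensor M M) (m n : M) :
    P.insert t (tmul m n) = tmul m (P.contractLeft n t) :=
  BalTensor.lift_btmul _ _ _ m n

/-- For t = m ⊗ n, balancing moves the scalar onto the first leg of g, where the right contraction
with m returns m. -/
theorem Metric.insert_g (G : Metric M) (t : Tensor M M) : G.pairing.insert t G.g = t := by
  have h1 : ∀ m n : M, ∀ s : Tensor M M,
      G.pairing.insert (tmul m n) s = tmul (G.pairing.contractRight m s) n := by
    intro m n s
    induction s using tensor_induction with
    | zero => simp only [map_zero, tmul, LinearMap.zero_apply]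
    | add s t hs ht => rw [map_add, hs, ht]; simp only [tmul, map_add, LinearMap.add_apply]
    | tmul x y =>
      rw [Pairing.insert_tmul, Pairing.contractLeft_tmul, Pairing.contractRight_tmul]
      exact (btmul_smul _ _ _ _).symm
  have h2 : ∀ s t r : Tensor M M,
      G.pairing.insert (s + t) r = G.pairing.insert s r + G.pairing.insert t r := by
    intro s t r
    induction r using tensor_induction with
    | zero => simp
    | add s t hs ht => rw [map_add, hs, ht, map_add, map_add]; abel
    | tmul x y => simp only [Pairing.insert_tmul, map_add]
  have h3 : ∀ r : Tensor M M, G.pairing.insert 0 r = 0 := by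
    intro r
    induction r using tensor_induction with
    | zero => simp
    | add s t hs ht => rw [map_add, hs, ht, add_zero]
    | tmul x y => simp only [Pairing.insert_tmul, map_zero]
  induction t using tensor_induction with
  | zero => exact h3 _
  | add s t hs ht => rw [h2, hs, ht]
  | tmul m n => rw [h1, G.contractRight_g]

/-- Inserting t after g involves only contractions of t, yet reproduces t. -/
theorem Metric.eq_zero_of_contract_eq_zero (G : Metric M) {t : Tensor M M}
    (h : ∀ ω, G.pairing.contractLeft ω t = 0) : t = 0 := by
  rw [← G.insert_g t]
  induction G.g using tensor_induction with
  | zero => simp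
  | add s r hs hr => rw [map_add, hs, hr, add_zero]
  | tmul m n => rw [Pairing.insert_tmul, h]; exact map_zero _

theorem Pairing.contractLeft_mem (P : Pairing M) {U V : Submodule ℂ M}
    (hV : ∀ (b : coinv π), ∀ m ∈ V, b • m ∈ V) (ω : M) {t : Tensor M M}
    (ht : t ∈ tensorSpan U V) : P.contractLeft ω t ∈ V := by
  have : tensorSpan U V ≤ V.comap (P.contractLeft ω) := by
    refine Submodule.map₂_le.2 fun m _ n hn => ?_
    rw [Submodule.mem_comap]
    exact (P.contractLeft_tmul ω m n).symm ▸ hV _ n hn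
  exact this ht

theorem Pairing.contractLeft_eq_zero (P : Pairing M) {U V : Submodule ℂ M} {ω : M}
    (h : ∀ m ∈ U, P.val ω m = 0) {t : Tensor M M} (ht : t ∈ tensorSpan U V) :
    P.contractLeft ω t = 0 := by
  have : tensorSpan U V ≤ LinearMap.ker (P.contractLeft ω) := by
    refine Submodule.map₂_le.2 fun m hm n _ => ?_
    rw [LinearMap.mem_ker]
    exact (P.contractLeft_tmul ω m n).trans (by rw [h m hm, zero_smul])
  exact this ht

/-- If both summands of `M = U ⊕ V` are isotropic, the metric has no component in `U ⊗ U` and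
`V ⊗ V`. -/
theorem Metric.g_mem_of_isotropic (G : Metric M) {U V : Submodule ℂ M} (hUV : IsCompl U V)
    (hU : ∀ (b : coinv π), ∀ m ∈ U, b • m ∈ U) (hV : ∀ (b : coinv π), ∀ m ∈ V, b • m ∈ V)
    (hUU : ∀ m ∈ U, ∀ n ∈ U, G.pairing.val m n = 0)
    (hVV : ∀ m ∈ V, ∀ n ∈ V, G.pairing.val m n = 0) :
    G.g ∈ tensorSpan U V ⊔ tensorSpan V U := by
  have htop : (tensorSpan U U ⊔ tensorSpan U V) ⊔ (tensorSpan V U ⊔ tensorSpan V V) =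
      (⊤ : Submodule ℂ (Tensor M M)) := by
    simp only [tensorSpan, ← Submodule.map₂_sup_right, ← Submodule.map₂_sup_left, hUV.sup_eq_top]
    rw [eq_top_iff]
    intro t _
    induction t using tensor_induction with
    | zero => exact Submodule.zero_mem _
    | add s t hs ht => exact Submodule.add_mem _ (hs trivial) (ht trivial)
    | tmul m n => exact Submodule.apply_mem_map₂ _ Submodule.mem_top Submodule.mem_top
  have hg := htop.symm ▸ (Submodule.mem_top : G.g ∈ (⊤ : Submodule ℂ (Tensor M M)))
  obtain ⟨x, hx, y, hy, hxy⟩ := Submodule.mem_sup.1 hg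
  obtain ⟨uu, huu, uv, huv, rfl⟩ := Submodule.mem_sup.1 hx
  obtain ⟨vu, hvu, vv, hvv, rfl⟩ := Submodule.mem_sup.1 hy
  have hsplit : ∀ (t : Tensor M M), (∀ ω ∈ U, G.pairing.contractLeft ω t = 0) →
      (∀ ω ∈ V, G.pairing.contractLeft ω t = 0) → t = 0 := by
    intro t h1 h2
    refine G.eq_zero_of_contract_eq_zero fun ω => ?_
    obtain ⟨x, hx, y, hy, rfl⟩ := Submodule.mem_sup.1
      (hUV.sup_eq_top.symm ▸ Submodule.mem_top : ω ∈ U ⊔ V)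
    rw [← Pairing.contract_apply, map_add, Pairing.contract_apply, Pairing.contract_apply,
      h1 x hx, h2 y hy, add_zero]
  -- For ω ∈ U isotropy kills the contractions of uu and uv, leaving ω = (term of vu in U) + (term
  -- of vv in V); the V-part is zero. For ω ∈ V isotropy kills vv directly.
  have hvv0 : vv = 0 := by
    refine hsplit vv (fun ω hω => ?_) fun ω hω => G.pairing.contractLeft_eq_zero (hVV ω hω) hvv
    have h := G.contractLeft_g ω
    rw [← hxy, map_add, map_add, map_add, G.pairing.contractLeft_eq_zero (hUU ω hω) huu,
      G.pairing.contractLeft_eq_zero (hUU ω hω) huv, zero_add, zero_add] at h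
    refine Submodule.disjoint_def.1 hUV.disjoint _ ?_ (G.pairing.contractLeft_mem hV ω hvv)
    rw [← eq_sub_iff_add_eq'] at h
    rw [h]
    exact U.sub_mem hω (G.pairing.contractLeft_mem hU ω hvu)
  have huu0 : uu = 0 := by
    refine hsplit uu (fun ω hω => G.pairing.contractLeft_eq_zero (hUU ω hω) huu) fun ω hω => ?_
    have h := G.contractLeft_g ω
    rw [← hxy, map_add, map_add, map_add, G.pairing.contractLeft_eq_zero (hVV ω hω) hvu,
      G.pairing.contractLeft_eq_zero (hVV ω hω) hvv, add_zero, add_zero] at h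
    refine Submodule.disjoint_def.1 hUV.disjoint _ (G.pairing.contractLeft_mem hU ω huu) ?_
    rw [← eq_sub_iff_add_eq] at h
    rw [h]
    exact V.sub_mem hω (G.pairing.contractLeft_mem hV ω huv)
  rw [← hxy, huu0, hvv0, zero_add, add_zero]
  exact Submodule.add_mem_sup huv hvu

end Contract

end RelHopfModule

/-! ### Conjugation and the metric on the two types of one-forms. -/

namespace CovariantComplexStructure

variable {A : Type u} {H : Type v} [Ring A] [HopfAlgebra ℂ A] [Ring H] [HopfAlgebra ℂ H]
  [StarRing A] [StarModule ℂ A] {π : A →ₐc[ℂ] H} {Ω : Type u} [Ring Ω] [Algebra ℂ Ω]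
  (C : CovariantComplexStructure π Ω)

theorem form_one_eq : C.form 1 = C.biform (0, 1) ⊔ C.biform (1, 0) := by
  rw [C.form_eq]
  have : Finset.HasAntidiagonal.antidiagonal 1 = {((0 : ℕ), (1 : ℕ)), (1, 0)} := rfl
  rw [this, Finset.iSup_insert, Finset.iSup_singleton]

/-- The inclusion `Ω¹ → Ω`. -/
def oneFormsIncl : C.oneForms →ₗ[ℂ] Ω := (C.form 1).subtype

theorem oneFormsIncl_injective : Function.Injective C.oneFormsIncl := Subtype.val_injective

/-- The inclusion `Ω^{(p,q)} → Ω`. -/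
def biformIncl (p q : ℕ) : C.biformObj p q →ₗ[ℂ] Ω := (C.biform (p, q)).subtype

theorem biformIncl_injective (p q : ℕ) : Function.Injective (C.biformIncl p q) :=
  Subtype.val_injective

theorem biformIncl_mem {p q : ℕ} (ω : C.biformObj p q) : C.biformIncl p q ω ∈ C.biform (p, q) :=
  Subtype.property _

theorem isCompl_holForms_antiholForms : IsCompl C.holForms C.antiholForms := by
  have hd : Disjoint (C.biform (1, 0)) (C.biform (0, 1)) :=
    C.biform_isInternal.submodule_iSupIndep.pairwiseDisjoint (by decide)
  refine ⟨?_, ?_⟩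
  · rw [Submodule.disjoint_def]
    intro x hx hx'
    exact Subtype.ext (Submodule.disjoint_def.1 hd _ hx hx')
  · rw [codisjoint_iff, eq_top_iff]
    intro x _
    have hx : C.oneFormsIncl x ∈ C.biform (0, 1) ⊔ C.biform (1, 0) :=
      C.form_one_eq ▸ Subtype.property _
    obtain ⟨y, hy, z, hz, hyz⟩ := Submodule.mem_sup.1 hx
    have hy1 : y ∈ C.form 1 := C.form_one_eq ▸ Submodule.mem_sup_left hy
    have hz1 : z ∈ C.form 1 := C.form_one_eq ▸ Submodule.mem_sup_right hz
    obtain ⟨y, rfl⟩ : ∃ y', C.oneFormsIncl y' = y := ⟨(⟨y, hy1⟩ : C.form 1), rfl⟩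
    obtain ⟨z, rfl⟩ : ∃ z', C.oneFormsIncl z' = z := ⟨(⟨z, hz1⟩ : C.form 1), rfl⟩
    rw [← map_add] at hyz
    rw [← C.oneFormsIncl_injective hyz, add_comm]
    exact Submodule.add_mem_sup hz hy

variable {p q : ℕ}

/-- The conjugation `Ω^{(p,q)} → Ω^{(q,p)}`. -/
def conjObj (p q : ℕ) : C.biformObj p q →ₛₗ[starRingEnd ℂ] C.biformObj q p :=
  LinearMap.codRestrict (C.biform (q, p)) (C.conj.comp (C.biformIncl p q))
    (fun ω => (C.conj_biform p q _).1 (C.biformIncl_mem ω))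

theorem biformIncl_conjObj (ω : C.biformObj p q) :
    C.biformIncl q p (C.conjObj p q ω) = C.conj (C.biformIncl p q ω) := rfl

theorem conjObj_conjObj (ω : C.biformObj p q) : C.conjObj q p (C.conjObj p q ω) = ω :=
  C.biformIncl_injective p q (C.conj_conj _)

theorem biformIncl_coact (ω : C.biformObj p q) :
    (C.biformIncl p q).lTensor A ((C.biformObj p q).coact ω) = C.coact (C.biformIncl p q ω) :=
  lTensor_restrictCoact A C.coact.toLinearMap (C.biform (p, q)) (C.coact_biform (p, q)) ω

theorem oneFormsIncl_coact (ω : C.oneForms) :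
    C.oneFormsIncl.lTensor A (C.oneForms.coact ω) = C.coact (C.oneFormsIncl ω) :=
  lTensor_restrictCoact A C.coact.toLinearMap (C.form 1) (C.coact_mem 1) ω

/-- The graded sign for degrees 0 and 1 is trivial. -/
theorem conjObj_lsmul (hpq : C.biform (p, q) ≤ C.form 1) (b b' : coinv π)
    (hb : (b' : A) = star (b : A)) (ω : C.biformObj p q) :
    C.conjObj p q (b • ω) = MulOpposite.op b' • C.conjObj p q ω := by
  apply C.biformIncl_injective q p
  have h := C.conj_mul 0 1 (C.ι b) (C.toCovariantCalculus.ι_mem b) (C.biformIncl p q ω)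
    (hpq (C.biformIncl_mem ω))
  rw [C.conj_ι b b' hb, zero_mul, pow_zero, one_mul] at h
  exact h

theorem coact_conjObj (ω : C.biformObj p q) : (C.biformObj q p).coact (C.conjObj p q ω) =
    TensorProduct.map (starLinearEquiv ℂ (A := A)).toLinearMap (C.conjObj p q)
      ((C.biformObj p q).coact ω) := by
  have hinj : Function.Injective ((C.biformIncl q p).lTensor A) :=
    lTensor_subtype_injective A (C.biform (q, p))
  apply hinj
  rw [biformIncl_coact, biformIncl_conjObj, C.coact_conj, ← biformIncl_coact]
  generalize (C.biformObj p q).coact ω = t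
  induction t with
  | zero => simp
  | add s t hs ht => simp only [map_add, hs, ht]
  | tmul a m => rfl

/-- The inclusion `Ω^{(p,q)} → Ω¹` for `p + q = 1`. -/
def inclOneForms (hpq : C.biform (p, q) ≤ C.form 1) : C.biformObj p q →ₗ[ℂ] C.oneForms :=
  Submodule.inclusion hpq

theorem oneFormsIncl_inclOneForms (hpq : C.biform (p, q) ≤ C.form 1) (ω : C.biformObj p q) :
    C.oneFormsIncl (C.inclOneForms hpq ω) = C.biformIncl p q ω := rfl

theorem coact_inclOneForms (hpq : C.biform (p, q) ≤ C.form 1) (ω : C.biformObj p q) :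
    C.oneForms.coact (C.inclOneForms hpq ω) =
      (C.inclOneForms hpq).lTensor A ((C.biformObj p q).coact ω) := by
  have hinj : Function.Injective (C.oneFormsIncl.lTensor A) :=
    lTensor_subtype_injective A (C.form 1)
  apply hinj
  rw [oneFormsIncl_coact, oneFormsIncl_inclOneForms, ← biformIncl_coact]
  exact LinearMap.lTensor_comp_apply A C.oneFormsIncl (C.inclOneForms hpq) _

/-- The restriction of the metric to Ω^{(p,q)} is again bilinear and colinear, so `pairing_eq_zero`
applies with the involution as conjugation. Keeping (p, q) general serves both types. -/
theorem pairing_inclOneForms_eq_zero [HopfStarAlgebra A] [StarRing H] [StarModule ℂ H]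
    (hH : IsCompactQuantumGroupAlgebra H) (hπ : ∀ a, π (star a) = star (π a))
    (hpq : C.biform (p, q) ≤ C.form 1) (hqp : C.biform (q, p) ≤ C.form 1)
    (h₁ : (C.biformObj p q).IsSimpleModZero) (h₂ : (C.biformObj q p).IsSimpleModZero)
    (hniso : ¬ RelHopfModule.Isomorphic (C.biformObj p q) (C.biformObj q p))
    (G : RelHopfModule.Metric C.oneForms) (hG : G.IsCovariant) (ω η : C.biformObj p q) :
    G.pairing.val (C.inclOneForms hpq ω) (C.inclOneForms hpq η) = 0 := by
  refine RelHopfModule.pairing_eq_zero hH hπ h₁ h₂ hniso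
    (G.pairing.val.compl₁₂ (C.inclOneForms hpq) (C.inclOneForms hpq))
    (fun b m n => G.pairing.val_lsmul b (C.inclOneForms hpq m) (C.inclOneForms hpq n))
    (fun b m n => G.pairing.val_rsmul b (C.inclOneForms hpq m) (C.inclOneForms hpq n)) ?_
    (C.conjObj p q) (C.conjObj q p) C.conjObj_conjObj (C.conjObj_lsmul hpq) (C.conjObj_lsmul hqp)
    C.coact_conjObj ω η
  intro m n
  have h := hG.pairing_colinear (RelHopfModule.tmul (C.inclOneForms hpq m) (C.inclOneForms hpq n))
  have h1 : RelHopfModule.tensorCoact C.oneForms C.oneForms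
      (RelHopfModule.tmul (C.inclOneForms hpq m) (C.inclOneForms hpq n)) =
      TensorProduct.map₂ (LinearMap.mul ℂ A) (btmul (coinv π))
        (C.oneForms.coact (C.inclOneForms hpq m)) (C.oneForms.coact (C.inclOneForms hpq n)) :=
    BalTensor.lift_btmul _ _ _ _ _
  rw [h1, coact_inclOneForms, coact_inclOneForms] at h
  refine h.trans ?_
  generalize (C.biformObj p q).coact m = s
  generalize (C.biformObj p q).coact n = t
  induction s with
  | zero => simp
  | add s s' hs hs' => simp only [map_add, LinearMap.add_apply, hs, hs']
  | tmul a m =>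
    induction t with
    | zero => simp
    | add t t' ht ht' => simp only [map_add, ht, ht']
    | tmul a' n => rfl

end CovariantComplexStructure

theorem RelHopfModule.Isomorphic.symm {A : Type u} {H : Type v} [Ring A] [HopfAlgebra ℂ A] [Ring H]
    [HopfAlgebra ℂ H] {π : A →ₐc[ℂ] H} {M N : RelHopfModule π} (h : Isomorphic M N) :
    Isomorphic N M :=
  let ⟨f, g, h₁, h₂⟩ := h
  ⟨g, f, h₂, h₁⟩

end

theorem mainTheorem11 {A : Type u} {H : Type v}
    [Ring A] [HopfAlgebra ℂ A] [StarRing A] [StarModule ℂ A] [HopfStarAlgebra A]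
    [Ring H] [HopfAlgebra ℂ H] [StarRing H] [StarModule ℂ H]
    (hH : IsCompactQuantumGroupAlgebra H)
    (π : A →ₐc[ℂ] H) (hπ_surj : Function.Surjective π) (hπ_star : ∀ a, π (star a) = star (π a))
    (hflat : IsFaithfullyFlatRight (coinv π) A)
    {Ω : Type u} [Ring Ω] [Algebra ℂ Ω] (C : CovariantComplexStructure π Ω)
    (hmod : C.oneForms.IsModZero)
    (hsimple₁₀ : (C.biformObj 1 0).IsSimpleModZero)
    (hsimple₀₁ : (C.biformObj 0 1).IsSimpleModZero)
    (hniso : ¬ RelHopfModule.Isomorphic (C.biformObj 1 0) (C.biformObj 0 1))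
    (G : RelHopfModule.Metric C.oneForms) (hG : G.IsCovariant) :
    (∀ ω η : C.oneForms,
      (ω ∈ C.holForms ∧ η ∈ C.holForms) ∨ (ω ∈ C.antiholForms ∧ η ∈ C.antiholForms) →
        G.pairing.toLin (RelHopfModule.tmul ω η) = 0) ∧
    G.g ∈ RelHopfModule.tensorSpan C.holForms C.antiholForms ⊔
      RelHopfModule.tensorSpan C.antiholForms C.holForms := by
  have h₁₀ : C.biform (1, 0) ≤ C.form 1 := C.form_one_eq ▸ le_sup_right
  have h₀₁ : C.biform (0, 1) ≤ C.form 1 := C.form_one_eq ▸ le_sup_left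
  have hhol : ∀ ω ∈ C.holForms, ∀ η ∈ C.holForms, G.pairing.val ω η = 0 := fun ω hω η hη =>
    C.pairing_inclOneForms_eq_zero hH hπ_star h₁₀ h₀₁ hsimple₁₀ hsimple₀₁ hniso G hG
      (⟨_, hω⟩ : C.biform (1, 0)) (⟨_, hη⟩ : C.biform (1, 0))
  have hanti : ∀ ω ∈ C.antiholForms, ∀ η ∈ C.antiholForms, G.pairing.val ω η = 0 :=
    fun ω hω η hη => C.pairing_inclOneForms_eq_zero hH hπ_star h₀₁ h₁₀ hsimple₀₁ hsimple₁₀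
      (fun h => hniso h.symm) G hG (⟨_, hω⟩ : C.biform (0, 1)) (⟨_, hη⟩ : C.biform (0, 1))
  refine ⟨?_, G.g_mem_of_isotropic C.isCompl_holForms_antiholForms
    (fun b m hm => ?_) (fun b m hm => ?_) hhol hanti⟩
  · rintro ω η (⟨hω, hη⟩ | ⟨hω, hη⟩)
    · exact hhol ω hω η hη
    · exact hanti ω hω η hη
  · have := C.biform_gradedMonoid
    -- The degree (0, 0) + (1, 0) reduces to (1, 0).
    exact SetLike.mul_mem_graded (C.ι_mem_biform b) hm
  · have := C.biform_gradedMonoid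
    exact SetLike.mul_mem_graded (C.ι_mem_biform b) hm
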